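/- For an irrational $x\in(0,1)$ let $x=[a_1(x),a_2(x),a_3(x),\ldots]$ be its simple continued fraction expansion, that is, $a_n(x)=\lfloor 1/T^{n-1}(x)\rfloor$ for $n\ge 1$, where $T$ is the Gauss map on $[0,1)$ given by $T(0)=0$ and $T(x)=\frac1x-\lfloor\frac1x\rfloor$ for $x\in(0,1)$. For $n\ge1$ put $$S_n(x)=\sum_{i=1}^n a_i(x)\,a_{i+1}(x).$$ Then for Lebesgue-almost every $x\in(0,1)$, $$\lim_{n\to\infty}\frac{S_n(x)-\max_{1\le i\le n}a_i(x)a_{i+1}(x)}{n\log^2 n}=\frac{1}{2\log 2},$$ where $\log$ is the natural logarithm and $\log^2 n=(\log n)^2$. -/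

import Mathlib

open Filter MeasureTheory
open scoped Topology

namespace ContFracSums

noncomputable section

/-- The Gauss map `T x = 1/x - ⌊1/x⌋` for `x ≠ 0`, with `T 0 = 0`. -/
def gaussMap (x : ℝ) : ℝ := if x = 0 then 0 else 1 / x - (⌊1 / x⌋ : ℝ)

/-- The `n`-th partial quotient `a_n(x) = ⌊1 / T^(n-1)(x)⌋` of `x ∈ (0,1)`, for `n ≥ 1`
(the index `0` is never used). -/
def partialQuotient (n : ℕ) (x : ℝ) : ℕ := ⌊1 / (gaussMap^[n - 1] x)⌋₊

/-- `S_n(x) = ∑_{i=1}^n a_i(x) a_{i+1}(x)`. -/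
def productSum (n : ℕ) (x : ℝ) : ℕ :=
  ∑ i ∈ Finset.Icc 1 n, partialQuotient i x * partialQuotient (i + 1) x

/-- `max_{1 ≤ i ≤ n} a_i(x) a_{i+1}(x)`; it is `0` for `n = 0`. -/
def productMax (n : ℕ) (x : ℝ) : ℕ :=
  (Finset.Icc 1 n).sup fun i => partialQuotient i x * partialQuotient (i + 1) x

end

end ContFracSums

namespace ContFracSums

noncomputable section

/-! The products of consecutive digits form a stationary process under the Gauss measure, with tail
of order `log N / N`. Their mean is infinite, and a single huge product can dominate the sum. Cut
off at `N`, a product has mean `log² N / (2 log 2)` up to `O(1 + log N)` (`truncMean_le`,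
`le_truncMean`) and second moment `O(N (1 + log N))` (`truncSq_le`). Removing the maximum removes
the only product that typically exceeds a level `N` slightly above `n`, so the trimmed sum equals
the truncated sum up to an error of at most `N` (`productSum_sub_productMax_bounds`).

The truncated sum concentrates because correlations decay exponentially. The transfer operator of
the Gauss map exchanges increasing and decreasing functions and halves their oscillation
(`abs_realTransfer_sub_le`). Its second iterate sends a function of two digits to a difference of
two decreasing functions, which gives decay relative to the mean
(`abs_integral_pair_mul_iterate_sub_le`) and a variance linear in `n` (`variance_truncSum_le`). Two
exceedances of `N` are unlikely: pairs at distance at least two are independent up to the factor 8,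
and adjacent pairs, which share a digit, have probability `O(1/N)` (`measure_doubleExceedSet_le`).

These bounds are summed along blocks with boundaries `exp (m ^ a)` and levels `exp (m ^ a) * m ^ b`.
The requirements are `a < 1`, so that consecutive boundaries have ratio tending to 1; `b < 2a`, so
that the level is negligible against the norming; and `b > 1`, `2b - 2a > 1`, `3a - b > 1`, so that
the adjacent exceedances, the distant exceedances and the normalized variances are summable. The
choice `a = 4/5`, `b = 4/3` makes the last two exponents both `16/15`. Borel-Cantelli and
Chebyshev-type summation give the limit at block boundaries, and monotonicity of the truncated sums
fills in the blocks (`tendsto_of_block_limits`). -/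

/-! ### Gauss measure, transfer operator and invariance. -/

/-- The Gauss measure `dx / ((1 + x) log 2)` on `(0,1)`. -/
def gaussMeasure : Measure ℝ :=
  (volume.restrict (Set.Ioo (0 : ℝ) 1)).withDensity
    fun x => ENNReal.ofReal ((Real.log 2)⁻¹ / (1 + x))

/-- The weight of the `k`-th inverse branch in the transfer operator. -/
def branchWeight (k : ℕ) (x : ℝ) : ℝ := (1 + x) / ((k + 1 + x) * (k + 2 + x))

/-- The transfer operator of the Gauss map with respect to the Gauss measure. -/
def transfer (f : ℝ → ENNReal) (x : ℝ) : ENNReal :=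
  ∑' k : ℕ, ENNReal.ofReal (branchWeight k x) * f (1 / (k + 1 + x))

/-- The first partial quotient. -/
def digit (x : ℝ) : ℕ := ⌊1 / x⌋₊

lemma measurable_gaussMap : Measurable gaussMap := by
  unfold gaussMap
  refine Measurable.ite (measurableSet_singleton 0) measurable_const ?_
  fun_prop

lemma measurable_digit : Measurable digit := by
  unfold digit
  fun_prop

lemma measurable_branchWeight (k : ℕ) : Measurable (branchWeight k) := by
  unfold branchWeight
  fun_prop

lemma measurable_transfer {f : ℝ → ENNReal} (hf : Measurable f) : Measurable (transfer f) := by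
  unfold transfer
  refine Measurable.tsum fun k => ?_
  exact (measurable_branchWeight k).ennreal_ofReal.mul (hf.comp (by fun_prop))

lemma digit_branch (k : ℕ) {y : ℝ} (hy : y ∈ Set.Ico (0 : ℝ) 1) :
    digit (1 / (k + 1 + y)) = k + 1 := by
  unfold digit
  rw [one_div_one_div, Nat.floor_eq_iff (by have := hy.1; positivity)]
  push_cast
  constructor <;> linarith [hy.1, hy.2]

lemma gaussMap_branch (k : ℕ) {y : ℝ} (hy : y ∈ Set.Ico (0 : ℝ) 1) :
    gaussMap (1 / (k + 1 + y)) = y := by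
  have h0 : (0 : ℝ) < k + 1 + y := by have := hy.1; positivity
  have hfl : ⌊(k + 1 + y : ℝ)⌋ = k + 1 := by
    rw [Int.floor_eq_iff]
    push_cast
    constructor <;> linarith [hy.1, hy.2]
  unfold gaussMap
  rw [if_neg (by positivity), one_div_one_div, hfl]
  push_cast
  ring

lemma iUnion_branch_image :
    ⋃ k : ℕ, (fun y : ℝ => 1 / (k + 1 + y)) '' Set.Ico (0 : ℝ) 1 = Set.Ioc 0 1 := by
  ext x
  simp only [Set.mem_iUnion, Set.mem_image, Set.mem_Ioc]
  constructor
  · rintro ⟨k, y, hy, rfl⟩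
    have h0 : (0 : ℝ) < k + 1 + y := by have := hy.1; positivity
    refine ⟨by positivity, ?_⟩
    rw [div_le_one h0]
    have : (0 : ℝ) ≤ k := by positivity
    linarith [hy.1]
  · rintro ⟨hx0, hx1⟩
    have h1 : 1 ≤ 1 / x := by rw [le_div_iff₀ hx0]; linarith
    have hf : 1 ≤ ⌊1 / x⌋₊ := Nat.le_floor (by exact_mod_cast h1)
    refine ⟨⌊1 / x⌋₊ - 1, 1 / x - ⌊1 / x⌋₊, ⟨?_, ?_⟩, ?_⟩
    · linarith [Nat.floor_le (zero_le_one.trans h1)]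
    · linarith [Nat.lt_floor_add_one (1 / x)]
    · push_cast [Nat.cast_sub hf]
      have : (⌊1 / x⌋₊ : ℝ) - 1 + 1 + (1 / x - ⌊1 / x⌋₊) = 1 / x := by ring
      rw [this, one_div_one_div]

lemma measurableSet_branch_image (k : ℕ) :
    MeasurableSet ((fun y : ℝ => 1 / (k + 1 + y)) '' Set.Ico (0 : ℝ) 1) := by
  refine MeasurableSet.image_of_measurable_injOn measurableSet_Ico (by fun_prop) ?_
  intro y hy z hz h
  rw [← gaussMap_branch k hy, ← gaussMap_branch k hz]
  exact congrArg gaussMap h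

lemma lintegral_gaussMeasure {f : ℝ → ENNReal} (hf : Measurable f) :
    ∫⁻ x, f x ∂gaussMeasure =
      ∫⁻ x in Set.Ioo (0 : ℝ) 1, ENNReal.ofReal ((Real.log 2)⁻¹ / (1 + x)) * f x := by
  unfold gaussMeasure
  rw [lintegral_withDensity_eq_lintegral_mul _ (by fun_prop) hf]
  rfl

/-- The transfer operator is dual to composition with the Gauss map. -/
lemma lintegral_mul_comp_gaussMap {f g : ℝ → ENNReal} (hf : Measurable f) (hg : Measurable g) :
    ∫⁻ x, f x * g (gaussMap x) ∂gaussMeasure = ∫⁻ x, transfer f x * g x ∂gaussMeasure := by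
  have hfg : Measurable fun x => f x * g (gaussMap x) := hf.mul (hg.comp measurable_gaussMap)
  have htg : Measurable fun x => transfer f x * g x := (measurable_transfer hf).mul hg
  -- The endpoints are null; with `Ico 0 1` as source, the branch images tile `Ioc 0 1` exactly.
  rw [lintegral_gaussMeasure hfg, lintegral_gaussMeasure htg,
    setLIntegral_congr Ioo_ae_eq_Ioc, setLIntegral_congr Ioo_ae_eq_Ico, ← iUnion_branch_image,
    lintegral_iUnion measurableSet_branch_image]
  swap
  · intro j k hjk
    refine Set.disjoint_left.2 ?_
    rintro _ ⟨y, hy, rfl⟩ ⟨z, hz, h⟩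
    have := congrArg digit h
    rw [digit_branch j hy, digit_branch k hz] at this
    omega
  -- Change of variables on one branch: the density at the image point times the Jacobian `1 / (k +
  -- 1 + y) ^ 2` is `branchWeight k y` times the density at `y`.
  have hterm : ∀ k : ℕ,
      ∫⁻ x in (fun y : ℝ => 1 / (k + 1 + y)) '' Set.Ico (0 : ℝ) 1,
        ENNReal.ofReal ((Real.log 2)⁻¹ / (1 + x)) * (f x * g (gaussMap x)) =
      ∫⁻ y in Set.Ico (0 : ℝ) 1, ENNReal.ofReal ((Real.log 2)⁻¹ / (1 + y)) *
        (ENNReal.ofReal (branchWeight k y) * f (1 / (k + 1 + y)) * g y) := by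
    intro k
    rw [lintegral_image_eq_lintegral_abs_deriv_mul (f' := fun y : ℝ => -1 / (k + 1 + y) ^ 2)
      measurableSet_Ico]
    · refine setLIntegral_congr_fun measurableSet_Ico fun y hy => ?_
      have h0 : (0 : ℝ) < k + 1 + y := by have := hy.1; positivity
      have h1 : (0 : ℝ) < 1 + y := by have := hy.1; positivity
      have hl : 0 < Real.log 2 := Real.log_pos (by norm_num)
      simp only [gaussMap_branch k hy]
      rw [← mul_assoc, ← mul_assoc, ← mul_assoc, ← mul_assoc, ← ENNReal.ofReal_mul (abs_nonneg _),
        ← ENNReal.ofReal_mul (by positivity)]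
      congr 3
      rw [abs_div, abs_neg, abs_one, abs_of_pos (by positivity : (0 : ℝ) < (k + 1 + y) ^ 2)]
      unfold branchWeight
      have h2 : (0 : ℝ) < k + 2 + y := by linarith
      have h3 : 1 + 1 / (k + 1 + y) = (k + 2 + y) / (k + 1 + y) := by field_simp; ring
      rw [h3]
      field_simp
    · intro y hy
      have h0 : (0 : ℝ) < k + 1 + y := by have := hy.1; positivity
      have : HasDerivAt (fun y : ℝ => (k + 1 + y)) 1 y := by
        simpa using (hasDerivAt_id y).const_add ((k : ℝ) + 1)
      simpa [one_div] using (this.fun_inv h0.ne').hasDerivWithinAt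
    · intro y hy z hz h
      rw [← gaussMap_branch k hy, ← gaussMap_branch k hz]
      exact congrArg gaussMap h
  simp_rw [hterm]
  rw [← lintegral_tsum]
  · refine lintegral_congr fun y => ?_
    rw [ENNReal.tsum_mul_left, ENNReal.tsum_mul_right]
    rfl
  · intro k
    refine Measurable.aemeasurable ?_
    refine Measurable.mul (by fun_prop) ?_
    exact ((measurable_branchWeight k).ennreal_ofReal.mul (hf.comp (by fun_prop))).mul hg

lemma branchWeight_nonneg (k : ℕ) {x : ℝ} (hx : 0 ≤ x) : 0 ≤ branchWeight k x := by
  unfold branchWeight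
  positivity

/-- The branch weights are differences of the tails `(1 + x) / (m + 1 + x)`. -/
lemma branchWeight_eq_sub (k : ℕ) {x : ℝ} (hx : 0 ≤ x) :
    branchWeight k x = (1 + x) / (k + 1 + x) - (1 + x) / ((k + 1 : ℕ) + 1 + x) := by
  unfold branchWeight
  push_cast
  have h1 : (k : ℝ) + 1 + x ≠ 0 := by positivity
  have h2 : (k : ℝ) + 2 + x ≠ 0 := by positivity
  have h3 : (k : ℝ) + 1 + 1 + x ≠ 0 := by positivity
  field_simp
  ring

/-- The series telescopes. Its sum is the transfer operator applied to the event that the first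
digit exceeds `m`; the case `m = 0` makes the operator an averaging operator. -/
lemma hasSum_branchWeight_tail (m : ℕ) {x : ℝ} (hx : 0 ≤ x) :
    HasSum (fun k => branchWeight (k + m) x) ((1 + x) / (m + 1 + x)) := by
  rw [hasSum_iff_tendsto_nat_of_nonneg fun k => branchWeight_nonneg _ hx]
  have h : ∀ n, ∑ k ∈ Finset.range n, branchWeight (k + m) x =
      (1 + x) / (m + 1 + x) - (1 + x) / ((n + m : ℕ) + 1 + x) := by
    intro n
    have := Finset.sum_range_sub' (fun k : ℕ => (1 + x) / ((k + m : ℕ) + 1 + x)) n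
    rw [zero_add] at this
    rw [← this]
    refine Finset.sum_congr rfl fun k _ => ?_
    rw [branchWeight_eq_sub _ hx, show k + m + 1 = k + 1 + m by ring]
  simp_rw [h]
  have : Tendsto (fun n : ℕ => (1 + x) / ((n + m : ℕ) + 1 + x)) atTop (𝓝 0) := by
    refine tendsto_const_nhds.div_atTop ?_
    refine tendsto_atTop_add_const_right _ _ (tendsto_atTop_add_const_right _ _ ?_)
    exact tendsto_natCast_atTop_atTop.comp (tendsto_add_atTop_nat m)
  simpa using this.const_sub ((1 + x) / (m + 1 + x))

lemma hasSum_branchWeight {x : ℝ} (hx : 0 ≤ x) : HasSum (fun k => branchWeight k x) 1 := by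
  have := hasSum_branchWeight_tail 0 hx
  simpa [div_self (show 1 + x ≠ 0 by positivity)] using this

lemma ae_gaussMeasure : ∀ᵐ x ∂gaussMeasure, x ∈ Set.Ioo (0 : ℝ) 1 :=
  (withDensity_absolutelyContinuous _ _).ae_le (ae_restrict_mem measurableSet_Ioo)

lemma transfer_one {x : ℝ} (hx : 0 ≤ x) : transfer (fun _ => 1) x = 1 := by
  unfold transfer
  simp only [mul_one]
  rw [← ENNReal.ofReal_tsum_of_nonneg (fun k => branchWeight_nonneg k hx)
    (hasSum_branchWeight hx).summable, (hasSum_branchWeight hx).tsum_eq, ENNReal.ofReal_one]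

lemma lintegral_comp_gaussMap {g : ℝ → ENNReal} (hg : Measurable g) :
    ∫⁻ x, g (gaussMap x) ∂gaussMeasure = ∫⁻ x, g x ∂gaussMeasure := by
  have := lintegral_mul_comp_gaussMap (f := fun _ => 1) measurable_const hg
  simp only [one_mul] at this
  rw [this]
  refine lintegral_congr_ae ?_
  filter_upwards [ae_gaussMeasure] with x hx
  rw [transfer_one hx.1.le, one_mul]

lemma measurePreserving_gaussMap : MeasurePreserving gaussMap gaussMeasure gaussMeasure := by
  refine ⟨measurable_gaussMap, ?_⟩
  refine Measure.ext_of_lintegral _ fun g hg => ?_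
  rw [lintegral_map hg measurable_gaussMap, lintegral_comp_gaussMap hg]

instance : IsProbabilityMeasure gaussMeasure := by
  constructor
  have h := lintegral_gaussMeasure (f := fun _ => 1) measurable_const
  simp only [lintegral_one, mul_one] at h
  rw [h]
  have hl : 0 < Real.log 2 := Real.log_pos (by norm_num)
  have hd : ∀ x ∈ Set.uIcc (0 : ℝ) 1,
      HasDerivAt (fun x => (Real.log 2)⁻¹ * Real.log (1 + x)) ((Real.log 2)⁻¹ / (1 + x)) x := by
    intro x hx
    rw [Set.uIcc_of_le zero_le_one] at hx
    have h1 : (1 + x) ≠ 0 := by linarith [hx.1]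
    have : HasDerivAt (fun x : ℝ => 1 + x) 1 x := by simpa using (hasDerivAt_id x).const_add 1
    simpa [div_eq_mul_inv] using (this.log h1).const_mul ((Real.log 2)⁻¹)
  have hc : ContinuousOn (fun x : ℝ => (Real.log 2)⁻¹ / (1 + x)) (Set.Icc 0 1) := by
    refine continuousOn_const.div (by fun_prop) fun x hx => ?_
    linarith [hx.1]
  have hi := intervalIntegral.integral_eq_sub_of_hasDerivAt hd
    (hc.intervalIntegrable_of_Icc zero_le_one)
  rw [intervalIntegral.integral_of_le zero_le_one, integral_Ioc_eq_integral_Ioo] at hi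
  rw [← ofReal_integral_eq_lintegral_ofReal, hi]
  · norm_num
  · exact (hc.integrableOn_Icc).mono_set Set.Ioo_subset_Icc_self
  · filter_upwards [ae_restrict_mem measurableSet_Ioo] with x hx
    have := hx.1
    simp only [Pi.zero_apply]
    positivity

/-- The Gauss density is positive on the interval, so almost sure statements pass back to Lebesgue
measure. -/
lemma restrict_absolutelyContinuous_gaussMeasure :
    volume.restrict (Set.Ioo (0 : ℝ) 1) ≪ gaussMeasure := by
  refine withDensity_absolutelyContinuous' (by fun_prop) ?_
  filter_upwards [ae_restrict_mem measurableSet_Ioo] with x hx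
  have := hx.1
  have hl : 0 < Real.log 2 := Real.log_pos (by norm_num)
  simp only [ne_eq, ENNReal.ofReal_eq_zero, not_le]
  positivity

/-! ### Contraction on monotone functions and decay of correlations. -/

/-- The transfer operator acting on real functions. -/
def realTransfer (h : ℝ → ℝ) (x : ℝ) : ℝ :=
  ∑' k : ℕ, branchWeight k x * h (1 / (k + 1 + x))

lemma measurable_realTransfer {h : ℝ → ℝ} (hh : Measurable h) : Measurable (realTransfer h) := by
  unfold realTransfer
  refine Measurable.tsum fun k => ?_
  exact (measurable_branchWeight k).mul (hh.comp (by fun_prop))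

lemma branch_mem_Icc (k : ℕ) {x : ℝ} (hx : 0 ≤ x) : 1 / (k + 1 + x) ∈ Set.Icc (0 : ℝ) 1 := by
  have : (0 : ℝ) ≤ k := by positivity
  refine ⟨by positivity, ?_⟩
  rw [div_le_one (by positivity)]
  linarith

lemma hasSum_realTransfer {h : ℝ → ℝ} {C : ℝ} (hC : ∀ x ∈ Set.Icc (0 : ℝ) 1, |h x| ≤ C)
    {x : ℝ} (hx : 0 ≤ x) :
    HasSum (fun k : ℕ => branchWeight k x * h (1 / (k + 1 + x))) (realTransfer h x) := by
  refine Summable.hasSum (Summable.of_norm_bounded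
    ((hasSum_branchWeight hx).summable.mul_right C) fun k => ?_)
  rw [Real.norm_eq_abs, abs_mul, abs_of_nonneg (branchWeight_nonneg k hx)]
  exact mul_le_mul_of_nonneg_left (hC _ (branch_mem_Icc k hx)) (branchWeight_nonneg k hx)

lemma realTransfer_mem_Icc {h : ℝ → ℝ} {a b : ℝ}
    (hab : ∀ x ∈ Set.Icc (0 : ℝ) 1, h x ∈ Set.Icc a b) {x : ℝ} (hx : 0 ≤ x) :
    realTransfer h x ∈ Set.Icc a b := by
  have hs := hasSum_realTransfer (C := max |a| |b|)
    (fun x hx => abs_le_max_abs_abs (hab x hx).1 (hab x hx).2) hx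
  have hw := hasSum_branchWeight hx
  constructor
  · have := hasSum_le (fun k => mul_le_mul_of_nonneg_left (hab _ (branch_mem_Icc k hx)).1
      (branchWeight_nonneg k hx)) (hw.mul_right a) hs
    linarith
  · have := hasSum_le (fun k => mul_le_mul_of_nonneg_left (hab _ (branch_mem_Icc k hx)).2
      (branchWeight_nonneg k hx)) hs (hw.mul_right b)
    linarith

lemma transfer_ofReal {h : ℝ → ℝ} {C : ℝ} (h0 : ∀ x ∈ Set.Icc (0 : ℝ) 1, 0 ≤ h x)
    (hC : ∀ x ∈ Set.Icc (0 : ℝ) 1, h x ≤ C) {x : ℝ} (hx : 0 ≤ x) :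
    transfer (fun y => ENNReal.ofReal (h y)) x = ENNReal.ofReal (realTransfer h x) := by
  have hs := hasSum_realTransfer (h := h) (C := C)
    (fun x hx => by rw [abs_of_nonneg (h0 x hx)]; exact hC x hx) hx
  unfold transfer realTransfer
  rw [ENNReal.ofReal_tsum_of_nonneg (fun k => mul_nonneg (branchWeight_nonneg k hx)
    (h0 _ (branch_mem_Icc k hx))) hs.summable]
  exact tsum_congr fun k => (ENNReal.ofReal_mul (branchWeight_nonneg k hx)).symm

lemma integral_mul_comp_gaussMap {h ψ : ℝ → ℝ} {C : ℝ} (hh : Measurable h)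
    (h0 : ∀ x ∈ Set.Icc (0 : ℝ) 1, 0 ≤ h x) (hC : ∀ x ∈ Set.Icc (0 : ℝ) 1, h x ≤ C)
    (hψ : Measurable ψ) (hψ0 : ∀ x, 0 ≤ ψ x) :
    ∫ x, h x * ψ (gaussMap x) ∂gaussMeasure = ∫ x, realTransfer h x * ψ x ∂gaussMeasure := by
  rw [integral_eq_lintegral_of_nonneg_ae, integral_eq_lintegral_of_nonneg_ae]
  · congr 1
    simp_rw [ENNReal.ofReal_mul' (hψ0 _)]
    rw [lintegral_mul_comp_gaussMap (f := fun x => ENNReal.ofReal (h x))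
      (g := fun x => ENNReal.ofReal (ψ x)) hh.ennreal_ofReal hψ.ennreal_ofReal]
    refine lintegral_congr_ae ?_
    filter_upwards [ae_gaussMeasure] with x hx
    rw [transfer_ofReal h0 hC hx.1.le]
  · filter_upwards [ae_gaussMeasure] with x hx
    refine mul_nonneg ?_ (hψ0 x)
    exact (realTransfer_mem_Icc (fun x hx => ⟨h0 x hx, hC x hx⟩) hx.1.le).1
  · exact ((measurable_realTransfer hh).mul hψ).aestronglyMeasurable
  · filter_upwards [ae_gaussMeasure] with x hx
    exact mul_nonneg (h0 x ⟨hx.1.le, hx.2.le⟩) (hψ0 _)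
  · exact (hh.mul (hψ.comp measurable_gaussMap)).aestronglyMeasurable

/-- The tails `(1 + x) / (m + 1 + x)` increase with `x`, so a larger `x` moves weight to larger
indices, where `b` is smaller. The proof is Abel summation. -/
lemma sum_branchWeight_mul_le {b : ℕ → ℝ} (hb : Antitone b) (hb0 : ∀ k, 0 ≤ b k) {x y : ℝ}
    (hx : 0 ≤ x) (hxy : x ≤ y) (n : ℕ) :
    ∑ k ∈ Finset.range n, branchWeight k y * b k ≤
      ∑ k ∈ Finset.range n, branchWeight k x * b k := by
  have hy : 0 ≤ y := hx.trans hxy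
  set t : ℕ → ℝ := fun k => (1 + y) / (k + 1 + y) - (1 + x) / (k + 1 + x) with ht
  have ht0 : ∀ k, 0 ≤ t k := by
    intro k
    have h1 : (0 : ℝ) < k + 1 + y := by positivity
    have h2 : (0 : ℝ) < k + 1 + x := by positivity
    simp only [ht, sub_nonneg]
    rw [div_le_div_iff₀ h2 h1]
    have : (0 : ℝ) ≤ k := by positivity
    nlinarith
  -- Keeping the boundary term of the Abel summation makes the induction close.
  have hkey : ∀ n, ∑ k ∈ Finset.range n, (branchWeight k y * b k - branchWeight k x * b k) ≤
      -(t n * b n) := by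
    intro n
    induction n with
    | zero =>
      have h1 : (1 + y) ≠ 0 := by positivity
      have h2 : (1 + x) ≠ 0 := by positivity
      simp [ht, h1, h2]
    | succ n ih =>
      rw [Finset.sum_range_succ]
      have hw : branchWeight n y - branchWeight n x = t n - t (n + 1) := by
        rw [branchWeight_eq_sub n hy, branchWeight_eq_sub n hx]
        simp only [ht]
        ring
      have := mul_le_mul_of_nonneg_left (hb (Nat.le_succ n)) (ht0 (n + 1))
      have h3 : branchWeight n y * b n - branchWeight n x * b n = (t n - t (n + 1)) * b n := by
        rw [← hw]; ring
      rw [h3]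
      simp only [Nat.succ_eq_add_one] at this
      linarith
  have := hkey n
  rw [Finset.sum_sub_distrib] at this
  linarith [mul_nonneg (ht0 n) (hb0 n)]

/-- Two effects point the same way as `x` grows: each branch point `1 / (k + 1 + x)` moves left, and
the weights shift towards larger `k`, that is, towards branch points further left. -/
lemma antitoneOn_realTransfer {h : ℝ → ℝ} (hm : MonotoneOn h (Set.Icc 0 1))
    (h0 : ∀ x ∈ Set.Icc (0 : ℝ) 1, 0 ≤ h x) :
    AntitoneOn (realTransfer h) (Set.Icc 0 1) := by
  have hC : ∀ x ∈ Set.Icc (0 : ℝ) 1, |h x| ≤ h 1 := fun x hx => by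
    rw [abs_of_nonneg (h0 x hx)]
    exact hm hx (Set.right_mem_Icc.2 zero_le_one) hx.2
  intro x hx y hy hxy
  refine le_of_tendsto_of_tendsto' (hasSum_realTransfer hC hy.1).tendsto_sum_nat
    (hasSum_realTransfer hC hx.1).tendsto_sum_nat fun n => ?_
  have hb : Antitone fun k : ℕ => h (1 / (k + 1 + x)) := by
    intro j k hjk
    refine hm (branch_mem_Icc k hx.1) (branch_mem_Icc j hx.1) ?_
    have : (j : ℝ) ≤ k := by exact_mod_cast hjk
    have hx0 := hx.1
    exact one_div_le_one_div_of_le (by positivity) (by linarith)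
  refine le_trans (Finset.sum_le_sum fun k _ => ?_)
    (sum_branchWeight_mul_le hb (fun k => h0 _ (branch_mem_Icc k hx.1)) hx.1 hxy n)
  refine mul_le_mul_of_nonneg_left ?_ (branchWeight_nonneg k hy.1)
  refine hm (branch_mem_Icc k hy.1) (branch_mem_Icc k hx.1) ?_
  have hx0 := hx.1
  exact one_div_le_one_div_of_le (by positivity) (by linarith)

lemma realTransfer_const_sub {h : ℝ → ℝ} {C : ℝ} (hC : ∀ x ∈ Set.Icc (0 : ℝ) 1, |h x| ≤ C)
    (c : ℝ) {x : ℝ} (hx : 0 ≤ x) :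
    realTransfer (fun y => c - h y) x = c - realTransfer h x := by
  have := ((hasSum_branchWeight hx).mul_right c).sub (hasSum_realTransfer hC hx)
  rw [one_mul] at this
  rw [← this.tsum_eq]
  unfold realTransfer
  simp_rw [mul_sub]

lemma monotoneOn_realTransfer {h : ℝ → ℝ} (hm : AntitoneOn h (Set.Icc 0 1))
    (h0 : ∀ x ∈ Set.Icc (0 : ℝ) 1, 0 ≤ h x) :
    MonotoneOn (realTransfer h) (Set.Icc 0 1) := by
  have hle : ∀ x ∈ Set.Icc (0 : ℝ) 1, h x ≤ h 0 :=
    fun x hx => hm (Set.left_mem_Icc.2 zero_le_one) hx hx.1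
  have hC : ∀ x ∈ Set.Icc (0 : ℝ) 1, |h x| ≤ h 0 := fun x hx => by
    rw [abs_of_nonneg (h0 x hx)]
    exact hle x hx
  have := antitoneOn_realTransfer (h := fun y => h 0 - h y)
    (fun x hx y hy hxy => sub_le_sub_left (hm hx hy hxy) _) (fun x hx => sub_nonneg.2 (hle x hx))
  intro x hx y hy hxy
  have h1 := this hx hy hxy
  rw [realTransfer_const_sub hC _ hx.1, realTransfer_const_sub hC _ hy.1] at h1
  linarith

/-- Branch `k + 1` at `0` and branch `k` at `1` hit the same point `1 / (k + 2)`, with weights in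
ratio one half; branch `0` at `0` contributes `h 1` with weight one half. This is the source of the
contraction factor. -/
lemma realTransfer_zero_eq {h : ℝ → ℝ} {C : ℝ} (hC : ∀ x ∈ Set.Icc (0 : ℝ) 1, |h x| ≤ C) :
    realTransfer h 0 = (h 1 + realTransfer h 1) / 2 := by
  have h1 := hasSum_realTransfer hC zero_le_one
  have h0 := hasSum_realTransfer hC le_rfl
  rw [← hasSum_nat_add_iff' 1] at h0
  have h2 := h1.mul_left (1 / 2)
  have h3 : (fun k : ℕ => 1 / 2 * (branchWeight k 1 * h (1 / (k + 1 + 1)))) =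
      fun k : ℕ => branchWeight (k + 1) 0 * h (1 / ((k + 1 : ℕ) + 1 + 0)) := by
    funext k
    unfold branchWeight
    push_cast
    simp only [add_zero]
    rw [← mul_assoc]
    congr 1
    field_simp
    ring
  rw [h3] at h2
  have := h0.unique h2
  simp [branchWeight] at this
  linarith

/-- The transfer operator halves the oscillation of a monotone function. -/
lemma abs_realTransfer_sub_le {h : ℝ → ℝ}
    (hm : MonotoneOn h (Set.Icc 0 1) ∨ AntitoneOn h (Set.Icc 0 1)) :
    |realTransfer h 1 - realTransfer h 0| ≤ 1 / 2 * |h 1 - h 0| := by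
  have m0 : (0 : ℝ) ∈ Set.Icc (0 : ℝ) 1 := Set.left_mem_Icc.2 zero_le_one
  have m1 : (1 : ℝ) ∈ Set.Icc (0 : ℝ) 1 := Set.right_mem_Icc.2 zero_le_one
  have hu : ∀ x ∈ Set.Icc (0 : ℝ) 1, h x ∈ Set.Icc (min (h 0) (h 1)) (max (h 0) (h 1)) := by
    intro x hx
    rcases hm with hm | hm
    · exact ⟨(min_le_left _ _).trans (hm m0 hx hx.1), (hm hx m1 hx.2).trans (le_max_right _ _)⟩
    · exact ⟨(min_le_right _ _).trans (hm hx m1 hx.2), (hm m0 hx hx.1).trans (le_max_left _ _)⟩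
  rw [realTransfer_zero_eq (fun x hx => abs_le_max_abs_abs (hu x hx).1 (hu x hx).2)]
  have h2 := realTransfer_mem_Icc hu zero_le_one
  -- It remains to compare `realTransfer h 1` with `h 1`; the former is an average of `h`, hence
  -- lies between `h 0` and `h 1`.
  have h3 : realTransfer h 1 - (h 1 + realTransfer h 1) / 2 =
    1 / 2 * (realTransfer h 1 - h 1) := by ring
  rw [h3, abs_mul, abs_of_pos (by norm_num : (0 : ℝ) < 1 / 2)]
  refine mul_le_mul_of_nonneg_left ?_ (by norm_num)
  have := Set.abs_sub_right_of_mem_uIcc (a := h 0) (b := h 1) (c := realTransfer h 1) h2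
  rwa [abs_sub_comm]

lemma integrable_of_mem_Icc {f : ℝ → ℝ} (hf : Measurable f) {a b : ℝ}
    (hab : ∀ x ∈ Set.Icc (0 : ℝ) 1, f x ∈ Set.Icc a b) : Integrable f gaussMeasure := by
  refine Integrable.of_bound hf.aestronglyMeasurable (max |a| |b|) ?_
  filter_upwards [ae_gaussMeasure] with x hx
  have := hab x ⟨hx.1.le, hx.2.le⟩
  exact abs_le_max_abs_abs this.1 this.2

lemma integral_realTransfer {h : ℝ → ℝ} {C : ℝ} (hh : Measurable h)
    (h0 : ∀ x ∈ Set.Icc (0 : ℝ) 1, 0 ≤ h x) (hC : ∀ x ∈ Set.Icc (0 : ℝ) 1, h x ≤ C) :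
    ∫ x, realTransfer h x ∂gaussMeasure = ∫ x, h x ∂gaussMeasure := by
  have := integral_mul_comp_gaussMap (ψ := fun _ => 1) hh h0 hC measurable_const
    (fun _ => zero_le_one)
  simpa using this.symm

/-- Exponential decay of correlations against monotone functions. -/
lemma abs_integral_mul_iterate_sub_le {ψ : ℝ → ℝ} {B : ℝ} (hψ : Measurable ψ)
    (hψ0 : ∀ x, 0 ≤ ψ x) (hψB : ∀ x, ψ x ≤ B) (n : ℕ) :
    ∀ h : ℝ → ℝ, Measurable h → (∀ x ∈ Set.Icc (0 : ℝ) 1, 0 ≤ h x) →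
      (MonotoneOn h (Set.Icc 0 1) ∨ AntitoneOn h (Set.Icc 0 1)) →
      |∫ x, h x * ψ (gaussMap^[n] x) ∂gaussMeasure -
          (∫ x, h x ∂gaussMeasure) * ∫ x, ψ x ∂gaussMeasure| ≤
        (1 / 2) ^ n * |h 1 - h 0| * ∫ x, ψ x ∂gaussMeasure := by
  have m0 : (0 : ℝ) ∈ Set.Icc (0 : ℝ) 1 := Set.left_mem_Icc.2 zero_le_one
  have m1 : (1 : ℝ) ∈ Set.Icc (0 : ℝ) 1 := Set.right_mem_Icc.2 zero_le_one
  have hψi : Integrable ψ gaussMeasure :=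
    integrable_of_mem_Icc hψ fun x _ => ⟨hψ0 x, hψB x⟩
  induction n with
  | zero =>
    intro h hh h0 hm
    have hu : ∀ x ∈ Set.Icc (0 : ℝ) 1, h x ∈ Set.uIcc (h 0) (h 1) := by
      intro x hx
      rcases hm with hm | hm
      · exact ⟨(min_le_left _ _).trans (hm m0 hx hx.1),
          (hm hx m1 hx.2).trans (le_max_right _ _)⟩
      · exact ⟨(min_le_right _ _).trans (hm hx m1 hx.2),
          (hm m0 hx hx.1).trans (le_max_left _ _)⟩
    have hhi : Integrable h gaussMeasure := integrable_of_mem_Icc hh hu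
    have hI : ∫ x, h x ∂gaussMeasure ∈ Set.uIcc (h 0) (h 1) := by
      constructor
      · have := integral_mono_ae (integrable_const (min (h 0) (h 1))) hhi
          (by filter_upwards [ae_gaussMeasure] with x hx using (hu x ⟨hx.1.le, hx.2.le⟩).1)
        simpa using this
      · have := integral_mono_ae hhi (integrable_const (max (h 0) (h 1)))
          (by filter_upwards [ae_gaussMeasure] with x hx using (hu x ⟨hx.1.le, hx.2.le⟩).2)
        simpa using this
    have hhψ : Integrable (fun x => h x * ψ x) gaussMeasure :=
      hhi.mul_bdd (c := B) hψ.aestronglyMeasurable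
        (ae_of_all _ fun x => by rw [Real.norm_eq_abs, abs_of_nonneg (hψ0 x)]; exact hψB x)
    simp only [Function.iterate_zero, id_eq, pow_zero, one_mul]
    rw [← integral_const_mul, ← integral_const_mul, ← integral_sub hhψ (hψi.const_mul _)]
    refine (abs_integral_le_integral_abs).trans ?_
    refine integral_mono_ae (hhψ.sub (hψi.const_mul _)).abs (hψi.const_mul _) ?_
    filter_upwards [ae_gaussMeasure] with x hx
    rw [← sub_mul, abs_mul, abs_of_nonneg (hψ0 x)]
    refine mul_le_mul_of_nonneg_right ?_ (hψ0 x)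
    have h1 := hu x ⟨hx.1.le, hx.2.le⟩
    exact Set.abs_sub_le_of_uIcc_subset_uIcc (Set.uIcc_subset_uIcc hI h1)
  | succ n ih =>
    intro h hh h0 hm
    have hC : ∃ C, ∀ x ∈ Set.Icc (0 : ℝ) 1, h x ≤ C := by
      rcases hm with hm | hm
      · exact ⟨h 1, fun x hx => hm hx m1 hx.2⟩
      · exact ⟨h 0, fun x hx => hm m0 hx hx.1⟩
    obtain ⟨C, hC⟩ := hC
    have hψn : Measurable fun x => ψ (gaussMap^[n] x) :=
      hψ.comp (measurable_gaussMap.iterate n)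
    have h1 := integral_mul_comp_gaussMap hh h0 hC hψn (fun x => hψ0 _)
    simp only [Function.iterate_succ_apply]
    rw [h1, ← integral_realTransfer hh h0 hC]
    refine (ih _ (measurable_realTransfer hh) (fun x hx =>
      (realTransfer_mem_Icc (fun x hx => ⟨h0 x hx, hC x hx⟩) hx.1).1) ?_).trans ?_
    -- The direction of monotonicity flips at each application, which is why the induction carries
    -- the disjunction.
    · rcases hm with hm | hm
      · exact Or.inr (antitoneOn_realTransfer hm h0)
      · exact Or.inl (monotoneOn_realTransfer hm h0)
    · refine mul_le_mul_of_nonneg_right ?_ (integral_nonneg hψ0)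
      rw [pow_succ, mul_assoc]
      exact mul_le_mul_of_nonneg_left (abs_realTransfer_sub_le hm) (by positivity)

/-! ### Functions of two consecutive digits. -/

/-- The second iterate of the transfer operator maps the indicator function of the cylinder
`a₁ = k + 1`, `a₂ = l + 1` to `(1 + y) * pairKernel k l y`. -/
def pairKernel (k l : ℕ) (y : ℝ) : ℝ :=
  1 / (((k + 1) * (l + 1 + y) + 1) * ((k + 2) * (l + 1 + y) + 1))

lemma pairKernel_pos (k l : ℕ) {y : ℝ} (hy : 0 ≤ y) : 0 < pairKernel k l y := by
  unfold pairKernel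
  positivity

lemma measurable_pairKernel (k l : ℕ) : Measurable (pairKernel k l) := by
  unfold pairKernel
  fun_prop

lemma antitoneOn_pairKernel (k l : ℕ) : AntitoneOn (pairKernel k l) (Set.Icc 0 1) := by
  intro x hx y hy hxy
  have hx0 := hx.1
  have hy0 := hy.1
  unfold pairKernel
  gcongr

lemma branchWeight_mul_branchWeight (k l : ℕ) {y : ℝ} (hy : 0 ≤ y) :
    branchWeight l y * branchWeight k (1 / (l + 1 + y)) = (1 + y) * pairKernel k l y := by
  unfold branchWeight pairKernel
  have h1 : (l : ℝ) + 1 + y ≠ 0 := by positivity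
  have h2 : (l : ℝ) + 2 + y ≠ 0 := by positivity
  have e1 : 1 + 1 / ((l : ℝ) + 1 + y) = (l + 2 + y) / (l + 1 + y) := by field_simp; ring
  have e2 : (k : ℝ) + 1 + 1 / (l + 1 + y) = ((k + 1) * (l + 1 + y) + 1) / (l + 1 + y) := by
    field_simp
  have e3 : (k : ℝ) + 2 + 1 / (l + 1 + y) = ((k + 2) * (l + 1 + y) + 1) / (l + 1 + y) := by
    field_simp
  have h3 : ((k : ℝ) + 1) * (l + 1 + y) + 1 ≠ 0 := by positivity
  have h4 : ((k : ℝ) + 2) * (l + 1 + y) + 1 ≠ 0 := by positivity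
  rw [e1, e2, e3]
  field_simp

/-- Each of the two factors in the denominator at most doubles between `0` and `y`. -/
lemma pairKernel_zero_le (k l : ℕ) {y : ℝ} (hy : y ∈ Set.Icc (0 : ℝ) 1) :
    pairKernel k l 0 ≤ 4 * pairKernel k l y := by
  unfold pairKernel
  have hy0 := hy.1
  rw [← div_eq_mul_one_div, div_le_div_iff₀ (by positivity) (by positivity)]
  have hk : (0 : ℝ) ≤ k := by positivity
  have hl : (0 : ℝ) ≤ l := by positivity
  have a1 : ((k : ℝ) + 1) * (l + 1 + y) + 1 ≤ 2 * ((k + 1) * (l + 1 + 0) + 1) := by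
    nlinarith [hy.2, mul_nonneg hk hl]
  have a2 : ((k : ℝ) + 2) * (l + 1 + y) + 1 ≤ 2 * ((k + 2) * (l + 1 + 0) + 1) := by
    nlinarith [hy.2, mul_nonneg hk hl]
  have := mul_le_mul a1 a2 (by positivity) (by positivity)
  linarith

lemma pairKernel_zero_le_inv (k l : ℕ) :
    pairKernel k l 0 ≤ 1 / (((k : ℝ) + 1) * (l + 1)) ^ 2 := by
  unfold pairKernel
  refine one_div_le_one_div_of_le (by positivity) ?_
  rw [sq]
  have hk : (0 : ℝ) ≤ k := by positivity
  have hl : (0 : ℝ) ≤ l := by positivity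
  refine mul_le_mul ?_ ?_ (by positivity) (by positivity) <;> nlinarith [mul_nonneg hk hl]

/-- The first factor cancels against the product of the digits in the truncated mean and leaves a
product of two harmonic terms. The shifts come from `(k + 2) ^ 2 ≤ (k + 1) * (k + 4)` and `(l + 3) ^
2 ≤ (l + 1) * (l + 9)`. -/
lemma le_pairKernel_one (k l : ℕ) :
    1 / (((k : ℝ) + 1) * (l + 1)) * (1 / ((k + 4) * (l + 9))) ≤ pairKernel k l 1 := by
  unfold pairKernel
  rw [one_div_mul_one_div]
  refine one_div_le_one_div_of_le (by positivity) ?_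
  have hk : (0 : ℝ) ≤ k := by positivity
  have hl : (0 : ℝ) ≤ l := by positivity
  have h1 : ((k : ℝ) + 1) * (l + 1 + 1) + 1 ≤ (k + 2) * (l + 3) := by nlinarith
  have h2 : ((k : ℝ) + 2) * (l + 1 + 1) + 1 ≤ (k + 2) * (l + 3) := by nlinarith
  have h3 : ((k : ℝ) + 2) ^ 2 ≤ (k + 1) * (k + 4) := by nlinarith
  have h4 : ((l : ℝ) + 3) ^ 2 ≤ (l + 1) * (l + 9) := by nlinarith
  calc _ ≤ ((k : ℝ) + 2) * (l + 3) * ((k + 2) * (l + 3)) := by gcongr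
    _ = (k + 2) ^ 2 * (l + 3) ^ 2 := by ring
    _ ≤ ((k + 1) * (k + 4)) * ((l + 1) * (l + 9)) := by gcongr
    _ = _ := by ring

lemma measurable_pair {α : Type*} [MeasurableSpace α] (Φ : ℕ → ℕ → α) :
    Measurable fun x => Φ (digit x) (digit (gaussMap x)) := by
  have h : Measurable fun p : ℕ × ℕ => Φ p.1 p.2 := measurable_of_countable _
  exact h.comp (measurable_digit.prodMk (measurable_digit.comp measurable_gaussMap))

lemma branch_mem_Ico_of_pos (k : ℕ) {x : ℝ} (hx : 0 < x) :
    1 / (k + 1 + x) ∈ Set.Ico (0 : ℝ) 1 := by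
  have : (0 : ℝ) ≤ k := by positivity
  refine ⟨by positivity, ?_⟩
  rw [div_lt_one (by positivity)]
  linarith

/-- The joint law of the first two digits and the second iterate of the Gauss map. -/
lemma lintegral_pair_mul (Φ : ℕ → ℕ → ENNReal) {g : ℝ → ENNReal} (hg : Measurable g) :
    ∫⁻ x, Φ (digit x) (digit (gaussMap x)) * g (gaussMap (gaussMap x)) ∂gaussMeasure =
      ∫⁻ y, (∑' l : ℕ, ∑' k : ℕ,
        ENNReal.ofReal ((1 + y) * pairKernel k l y) * Φ (k + 1) (l + 1)) * g y ∂gaussMeasure := by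
  have hΦ := measurable_pair Φ
  rw [lintegral_mul_comp_gaussMap (g := fun x => g (gaussMap x)) hΦ (hg.comp measurable_gaussMap),
    lintegral_mul_comp_gaussMap (measurable_transfer hΦ) hg]
  refine lintegral_congr_ae ?_
  filter_upwards [ae_gaussMeasure] with y hy
  congr 1
  unfold transfer
  -- The outer application of the operator selects the second digit, the inner one the first digit.
  refine tsum_congr fun l => ?_
  rw [← ENNReal.tsum_mul_left]
  refine tsum_congr fun k => ?_
  have hb := branch_mem_Ico_of_pos l hy.1
  beta_reduce
  rw [← branchWeight_mul_branchWeight k l hy.1.le, digit_branch k hb, gaussMap_branch k hb,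
    digit_branch l ⟨hy.1.le, hy.2⟩, ENNReal.ofReal_mul (branchWeight_nonneg l hy.1.le), mul_assoc]

/-- Quasi-independence of the first two digits and the second iterate of the Gauss map. -/
lemma lintegral_pair_mul_le (Φ : ℕ → ℕ → ENNReal) {g : ℝ → ENNReal} (hg : Measurable g) :
    ∫⁻ x, Φ (digit x) (digit (gaussMap x)) * g (gaussMap (gaussMap x)) ∂gaussMeasure ≤
      8 * (∫⁻ x, Φ (digit x) (digit (gaussMap x)) ∂gaussMeasure) * ∫⁻ x, g x ∂gaussMeasure := by
  set H : ℝ → ENNReal := fun y => ∑' l : ℕ, ∑' k : ℕ,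
        ENNReal.ofReal ((1 + y) * pairKernel k l y) * Φ (k + 1) (l + 1) with hH
  have h1 : ∫⁻ x, Φ (digit x) (digit (gaussMap x)) ∂gaussMeasure = ∫⁻ y, H y ∂gaussMeasure := by
    have := lintegral_pair_mul Φ (g := fun _ => 1) measurable_const
    simpa using this
  -- The factor 8 is 4 from `pairKernel_zero_le` times 2 from `1 + y`.
  have hHle : ∀ y ∈ Set.Icc (0 : ℝ) 1, ∀ z ∈ Set.Icc (0 : ℝ) 1, H y ≤ 8 * H z := by
    intro y hy z hz
    simp only [hH]
    rw [← ENNReal.tsum_mul_left]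
    refine ENNReal.tsum_le_tsum fun l => ?_
    rw [← ENNReal.tsum_mul_left]
    refine ENNReal.tsum_le_tsum fun k => ?_
    rw [← mul_assoc]
    gcongr
    rw [show (8 : ENNReal) = ENNReal.ofReal 8 by norm_num, ← ENNReal.ofReal_mul (by norm_num)]
    refine ENNReal.ofReal_le_ofReal ?_
    have m0 : (0 : ℝ) ∈ Set.Icc (0 : ℝ) 1 := Set.left_mem_Icc.2 zero_le_one
    have a := antitoneOn_pairKernel k l m0 hy hy.1
    have b := pairKernel_zero_le k l hz
    have c := pairKernel_pos k l hy.1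
    have d := pairKernel_pos k l hz.1
    nlinarith [hy.1, hy.2, hz.1, hz.2, mul_nonneg hz.1 d.le, mul_le_mul_of_nonneg_right hy.2 c.le]
  have hHI : ∀ y ∈ Set.Icc (0 : ℝ) 1, H y ≤ 8 * ∫⁻ z, H z ∂gaussMeasure := by
    intro y hy
    rw [← lintegral_const_mul']
    · calc H y = ∫⁻ _, H y ∂gaussMeasure := by simp
        _ ≤ _ := by
          refine lintegral_mono_ae ?_
          filter_upwards [ae_gaussMeasure] with z hz
          exact hHle y hy z ⟨hz.1.le, hz.2.le⟩
    · norm_num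
  rw [lintegral_pair_mul Φ hg, h1, ← lintegral_const_mul _ hg]
  refine lintegral_mono_ae ?_
  filter_upwards [ae_gaussMeasure] with y hy
  gcongr
  exact hHI y ⟨hy.1.le, hy.2.le⟩

/-- Real version of `lintegral_pair_mul` for functions of finite support. -/
lemma integral_pair_mul {φ : ℕ → ℕ → ℝ} (hφ : ∀ k l, 0 ≤ φ k l) {N : ℕ}
    (hN : ∀ k l, N < k * l → φ k l = 0) {ψ : ℝ → ℝ} (hψ : Measurable ψ) (hψ0 : ∀ x, 0 ≤ ψ x) :
    ∫ x, φ (digit x) (digit (gaussMap x)) * ψ (gaussMap (gaussMap x)) ∂gaussMeasure =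
      ∫ y, (∑ l ∈ Finset.range N, ∑ k ∈ Finset.range N,
        (1 + y) * pairKernel k l y * φ (k + 1) (l + 1)) * ψ y ∂gaussMeasure := by
  rw [integral_eq_lintegral_of_nonneg_ae, integral_eq_lintegral_of_nonneg_ae]
  · congr 1
    simp_rw [ENNReal.ofReal_mul' (hψ0 _)]
    rw [lintegral_pair_mul (fun k l => ENNReal.ofReal (φ k l))
      (g := fun x => ENNReal.ofReal (ψ x)) hψ.ennreal_ofReal]
    refine lintegral_congr_ae ?_
    filter_upwards [ae_gaussMeasure] with y hy
    congr 1
    have hnn : ∀ k l, 0 ≤ (1 + y) * pairKernel k l y := fun k l =>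
      mul_nonneg (by linarith [hy.1]) (pairKernel_pos k l hy.1.le).le
    rw [ENNReal.ofReal_sum_of_nonneg
      fun l _ => Finset.sum_nonneg fun k _ => mul_nonneg (hnn k l) (hφ _ _)]
    rw [tsum_eq_sum (s := Finset.range N)]
    · refine Finset.sum_congr rfl fun l _ => ?_
      rw [ENNReal.ofReal_sum_of_nonneg fun k _ => mul_nonneg (hnn k l) (hφ _ _)]
      rw [tsum_eq_sum (s := Finset.range N)]
      · exact Finset.sum_congr rfl fun k _ => (ENNReal.ofReal_mul (hnn k l)).symm
      · intro k hk
        rw [hN, ENNReal.ofReal_zero, mul_zero]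
        have : N ≤ k := by simpa using hk
        nlinarith
    · intro l hl
      rw [ENNReal.tsum_eq_zero]
      intro k
      rw [hN, ENNReal.ofReal_zero, mul_zero]
      have : N ≤ l := by simpa using hl
      nlinarith
  · filter_upwards [ae_gaussMeasure] with y hy
    exact mul_nonneg (Finset.sum_nonneg fun l _ => Finset.sum_nonneg fun k _ =>
      mul_nonneg (mul_nonneg (by linarith [hy.1]) (pairKernel_pos k l hy.1.le).le) (hφ _ _))
      (hψ0 y)
  · refine Measurable.aestronglyMeasurable (Measurable.mul ?_ hψ)
    refine Finset.measurable_sum _ fun l _ => Finset.measurable_sum _ fun k _ => ?_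
    have := measurable_pairKernel k l
    fun_prop
  · exact ae_of_all _ fun x => mul_nonneg (hφ _ _) (hψ0 _)
  · exact ((measurable_pair φ).mul (hψ.comp (measurable_gaussMap.comp
      measurable_gaussMap))).aestronglyMeasurable

/-- Exponential decay of correlations for functions of two consecutive digits. -/
lemma abs_integral_pair_mul_iterate_sub_le {φ : ℕ → ℕ → ℝ} (hφ : ∀ k l, 0 ≤ φ k l) {N : ℕ}
    (hN : ∀ k l, N < k * l → φ k l = 0) {ψ : ℝ → ℝ} {B : ℝ} (hψ : Measurable ψ)
    (hψ0 : ∀ x, 0 ≤ ψ x) (hψB : ∀ x, ψ x ≤ B) (n : ℕ) :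
    |∫ x, φ (digit x) (digit (gaussMap x)) * ψ (gaussMap^[n + 2] x) ∂gaussMeasure -
        (∫ x, φ (digit x) (digit (gaussMap x)) ∂gaussMeasure) * ∫ x, ψ x ∂gaussMeasure| ≤
      (1 / 2) ^ n * 12 * (∫ x, φ (digit x) (digit (gaussMap x)) ∂gaussMeasure) *
        ∫ x, ψ x ∂gaussMeasure := by
  set V : ℝ → ℝ := fun y => ∑ l ∈ Finset.range N, ∑ k ∈ Finset.range N,
    pairKernel k l y * φ (k + 1) (l + 1) with hV
  have m0 : (0 : ℝ) ∈ Set.Icc (0 : ℝ) 1 := Set.left_mem_Icc.2 zero_le_one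
  have m1 : (1 : ℝ) ∈ Set.Icc (0 : ℝ) 1 := Set.right_mem_Icc.2 zero_le_one
  have hVm : Measurable V := by
    refine Finset.measurable_sum _ fun l _ => Finset.measurable_sum _ fun k _ => ?_
    have := measurable_pairKernel k l
    fun_prop
  have hVanti : AntitoneOn V (Set.Icc 0 1) := by
    intro x hx y hy hxy
    refine Finset.sum_le_sum fun l _ => Finset.sum_le_sum fun k _ => ?_
    exact mul_le_mul_of_nonneg_right (antitoneOn_pairKernel k l hx hy hxy) (hφ _ _)
  have hV0 : ∀ x ∈ Set.Icc (0 : ℝ) 1, 0 ≤ V x := fun x hx =>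
    Finset.sum_nonneg fun l _ => Finset.sum_nonneg fun k _ =>
      mul_nonneg (pairKernel_pos k l hx.1).le (hφ _ _)
  have hV4 : ∀ x ∈ Set.Icc (0 : ℝ) 1, V 0 ≤ 4 * V x := by
    intro x hx
    simp only [hV, Finset.mul_sum]
    refine Finset.sum_le_sum fun l _ => Finset.sum_le_sum fun k _ => ?_
    rw [← mul_assoc]
    exact mul_le_mul_of_nonneg_right (pairKernel_zero_le k l hx) (hφ _ _)
  have hVle : ∀ x ∈ Set.Icc (0 : ℝ) 1, V x ≤ V 0 := fun x hx => hVanti m0 hx hx.1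
  -- `(1 + y) * V y` need not be monotone; it is split into a difference of two nonnegative
  -- decreasing functions, to which the decay estimate applies separately.
  have hW : ∀ y, (∑ l ∈ Finset.range N, ∑ k ∈ Finset.range N,
      (1 + y) * pairKernel k l y * φ (k + 1) (l + 1)) = 2 * V y - (1 - y) * V y := by
    intro y
    rw [← sub_mul]
    simp only [hV, Finset.mul_sum]
    refine Finset.sum_congr rfl fun l _ => Finset.sum_congr rfl fun k _ => ?_
    ring
  have hFm : Measurable fun y => 2 * V y := by fun_prop
  have hGm : Measurable fun y => (1 - y) * V y := by fun_prop
  have hF0 : ∀ x ∈ Set.Icc (0 : ℝ) 1, 0 ≤ 2 * V x := fun x hx => by linarith [hV0 x hx]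
  have hG0 : ∀ x ∈ Set.Icc (0 : ℝ) 1, 0 ≤ (1 - x) * V x := fun x hx =>
    mul_nonneg (by linarith [hx.2]) (hV0 x hx)
  have hFle : ∀ x ∈ Set.Icc (0 : ℝ) 1, 2 * V x ≤ 2 * V 0 := fun x hx => by linarith [hVle x hx]
  have hGle : ∀ x ∈ Set.Icc (0 : ℝ) 1, (1 - x) * V x ≤ V 0 := fun x hx => by
    nlinarith [hVle x hx, hV0 x hx, hx.1, mul_nonneg hx.1 (hV0 x hx)]
  have hFanti : AntitoneOn (fun y => 2 * V y) (Set.Icc 0 1) := fun x hx y hy hxy =>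
    mul_le_mul_of_nonneg_left (hVanti hx hy hxy) (by norm_num)
  have hGanti : AntitoneOn (fun y => (1 - y) * V y) (Set.Icc 0 1) := fun x hx y hy hxy =>
    mul_le_mul (by linarith) (hVanti hx hy hxy) (hV0 y hy) (by linarith [hx.2])
  have hFi : Integrable (fun y => 2 * V y) gaussMeasure :=
    integrable_of_mem_Icc hFm fun x hx => ⟨hF0 x hx, hFle x hx⟩
  have hGi : Integrable (fun y => (1 - y) * V y) gaussMeasure :=
    integrable_of_mem_Icc hGm fun x hx => ⟨hG0 x hx, hGle x hx⟩
  have hI : ∫ x, φ (digit x) (digit (gaussMap x)) ∂gaussMeasure =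
      ∫ y, 2 * V y ∂gaussMeasure - ∫ y, (1 - y) * V y ∂gaussMeasure := by
    have := integral_pair_mul hφ hN (ψ := fun _ => 1) measurable_const (fun _ => zero_le_one)
    simp only [mul_one, hW] at this
    rw [this, integral_sub hFi hGi]
  have hbd : ∀ x, ‖ψ (gaussMap^[n] x)‖ ≤ B := fun x => by
    rw [Real.norm_eq_abs, abs_of_nonneg (hψ0 _)]
    exact hψB _
  have hψn : Measurable fun x => ψ (gaussMap^[n] x) :=
    hψ.comp (measurable_gaussMap.iterate n)
  have hJ : ∫ x, φ (digit x) (digit (gaussMap x)) * ψ (gaussMap^[n + 2] x) ∂gaussMeasure =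
      ∫ y, 2 * V y * ψ (gaussMap^[n] y) ∂gaussMeasure -
        ∫ y, (1 - y) * V y * ψ (gaussMap^[n] y) ∂gaussMeasure := by
    have := integral_pair_mul hφ hN hψn (fun _ => hψ0 _)
    simp only [hW] at this
    simp only [Function.iterate_succ_apply]
    rw [this, ← integral_sub (hFi.mul_bdd hψn.aestronglyMeasurable (ae_of_all _ hbd))
      (hGi.mul_bdd hψn.aestronglyMeasurable (ae_of_all _ hbd))]
    simp_rw [sub_mul]
  -- Bounding the oscillations by the mean makes the final error relative; the constant 12 is this 4
  -- times the total oscillation bound `3 * V 0`.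
  have hVI : V 0 ≤ 4 * ∫ x, φ (digit x) (digit (gaussMap x)) ∂gaussMeasure := by
    rw [hI, ← integral_sub hFi hGi, ← integral_const_mul]
    have := integral_mono_ae (integrable_const (V 0)) ((hFi.sub hGi).const_mul 4)
      (μ := gaussMeasure) (by
        filter_upwards [ae_gaussMeasure] with y hy
        have hy' : y ∈ Set.Icc (0 : ℝ) 1 := ⟨hy.1.le, hy.2.le⟩
        simp only [Pi.sub_apply]
        nlinarith [hV4 y hy', mul_nonneg hy.1.le (hV0 y hy')])
    simpa using this
  have d1 := abs_integral_mul_iterate_sub_le hψ hψ0 hψB n _ hFm hF0 (Or.inr hFanti)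
  have d2 := abs_integral_mul_iterate_sub_le hψ hψ0 hψB n _ hGm hG0 (Or.inr hGanti)
  have hΨ : 0 ≤ ∫ x, ψ x ∂gaussMeasure := integral_nonneg hψ0
  have e1 : |2 * V 1 - 2 * V 0| ≤ 2 * V 0 := by
    rw [abs_le]; constructor <;> linarith [hVle 1 m1, hV0 1 m1]
  have e2 : |(1 - 1) * V 1 - (1 - 0) * V 0| ≤ V 0 := by
    rw [abs_le]; constructor <;> linarith [hVle 1 m1, hV0 1 m1]
  have hp : (0 : ℝ) ≤ (1 / 2) ^ n := by positivity
  rw [hJ, hI]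
  rw [hI] at hVI
  set F1 := ∫ y, 2 * V y * ψ (gaussMap^[n] y) ∂gaussMeasure
  set G1 := ∫ y, (1 - y) * V y * ψ (gaussMap^[n] y) ∂gaussMeasure
  set F0 := ∫ y, 2 * V y ∂gaussMeasure
  set G0 := ∫ y, (1 - y) * V y ∂gaussMeasure
  set Ψ := ∫ x, ψ x ∂gaussMeasure
  calc |F1 - G1 - (F0 - G0) * Ψ| = |(F1 - F0 * Ψ) - (G1 - G0 * Ψ)| := by congr 1; ring
    _ ≤ |F1 - F0 * Ψ| + |G1 - G0 * Ψ| := abs_sub _ _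
    _ ≤ (1 / 2) ^ n * (2 * V 0) * Ψ + (1 / 2) ^ n * V 0 * Ψ := by
        refine add_le_add (d1.trans ?_) (d2.trans ?_) <;> gcongr
    _ = (1 / 2) ^ n * 3 * V 0 * Ψ := by ring
    _ ≤ (1 / 2) ^ n * 3 * (4 * (F0 - G0)) * Ψ := by gcongr
    _ = _ := by ring

/-! ### Truncated products and the variance of their sums. -/

/-- The product of `k` and `l`, replaced by `0` when it exceeds `N`. -/
def truncPair (N k l : ℕ) : ℝ := if k * l ≤ N then ((k * l : ℕ) : ℝ) else 0

/-- The product of the first two digits, truncated at `N`. -/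
def truncProd (N : ℕ) (x : ℝ) : ℝ := truncPair N (digit x) (digit (gaussMap x))

/-- The Birkhoff sums of `truncProd N`. -/
def truncSum (N n : ℕ) (x : ℝ) : ℝ := ∑ i ∈ Finset.range n, truncProd N (gaussMap^[i] x)

/-- The mean of `truncProd N`. -/
def truncMean (N : ℕ) : ℝ := ∫ x, truncProd N x ∂gaussMeasure

/-- The second moment of `truncProd N`. -/
def truncSq (N : ℕ) : ℝ := ∫ x, truncProd N x ^ 2 ∂gaussMeasure

lemma truncPair_nonneg (N k l : ℕ) : 0 ≤ truncPair N k l := by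
  unfold truncPair
  split_ifs <;> positivity

lemma truncPair_le (N k l : ℕ) : truncPair N k l ≤ N := by
  unfold truncPair
  split_ifs with h
  · exact_mod_cast h
  · positivity

lemma truncPair_eq_zero {N : ℕ} (k l : ℕ) (h : N < k * l) : truncPair N k l = 0 :=
  if_neg (not_le.2 h)

lemma measurable_truncProd (N : ℕ) : Measurable (truncProd N) := measurable_pair _

lemma truncProd_nonneg (N : ℕ) (x : ℝ) : 0 ≤ truncProd N x := truncPair_nonneg _ _ _

lemma truncProd_le (N : ℕ) (x : ℝ) : truncProd N x ≤ N := truncPair_le _ _ _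

lemma measurable_truncSum (N n : ℕ) : Measurable (truncSum N n) :=
  Finset.measurable_sum _ fun i _ => (measurable_truncProd N).comp (measurable_gaussMap.iterate i)

lemma truncSum_nonneg (N n : ℕ) (x : ℝ) : 0 ≤ truncSum N n x :=
  Finset.sum_nonneg fun _ _ => truncProd_nonneg _ _

lemma truncSum_le (N n : ℕ) (x : ℝ) : truncSum N n x ≤ n * N := by
  have := Finset.sum_le_card_nsmul (Finset.range n) (fun i => truncProd N (gaussMap^[i] x)) N
    fun i _ => truncProd_le _ _
  simpa [truncSum] using this

lemma truncSum_succ (N n : ℕ) (x : ℝ) :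
    truncSum N (n + 1) x = truncSum N n (gaussMap x) + truncProd N x := by
  unfold truncSum
  rw [Finset.sum_range_succ']
  simp

lemma measurePreserving_iterate (n : ℕ) :
    MeasurePreserving gaussMap^[n] gaussMeasure gaussMeasure :=
  measurePreserving_gaussMap.iterate n

lemma integral_comp_iterate {f : ℝ → ℝ} (hf : Measurable f) (n : ℕ) :
    ∫ x, f (gaussMap^[n] x) ∂gaussMeasure = ∫ x, f x ∂gaussMeasure := by
  have hT := measurePreserving_iterate n
  rw [← integral_map hT.measurable.aemeasurable hf.aestronglyMeasurable, hT.map_eq]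

lemma integrable_comp_iterate {f : ℝ → ℝ} (hf : Integrable f gaussMeasure) (n : ℕ) :
    Integrable (fun x => f (gaussMap^[n] x)) gaussMeasure :=
  (measurePreserving_iterate n).integrable_comp_of_integrable hf

lemma integrable_comp_gaussMap {f : ℝ → ℝ} (hf : Integrable f gaussMeasure) :
    Integrable (fun x => f (gaussMap x)) gaussMeasure :=
  measurePreserving_gaussMap.integrable_comp_of_integrable hf

lemma integral_comp_gaussMap {f : ℝ → ℝ} (hf : Measurable f) :
    ∫ x, f (gaussMap x) ∂gaussMeasure = ∫ x, f x ∂gaussMeasure :=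
  integral_comp_iterate hf 1

lemma integrable_of_abs_le {f : ℝ → ℝ} (hf : Measurable f) {C : ℝ} (hC : ∀ x, |f x| ≤ C) :
    Integrable f gaussMeasure :=
  Integrable.of_bound hf.aestronglyMeasurable C (ae_of_all _ hC)

lemma abs_truncProd_le (N : ℕ) (x : ℝ) : |truncProd N x| ≤ N := by
  rw [abs_of_nonneg (truncProd_nonneg N x)]
  exact truncProd_le N x

lemma integrable_truncProd (N : ℕ) : Integrable (truncProd N) gaussMeasure :=
  integrable_of_abs_le (measurable_truncProd N) (abs_truncProd_le N)

lemma integrable_truncProd_mul (N n : ℕ) :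
    Integrable (fun x => truncProd N x * truncProd N (gaussMap^[n] x)) gaussMeasure := by
  refine integrable_of_abs_le (C := N * N) ((measurable_truncProd N).mul
    ((measurable_truncProd N).comp (measurable_gaussMap.iterate n))) fun x => ?_
  rw [abs_mul]
  exact mul_le_mul (abs_truncProd_le N x) (abs_truncProd_le N _) (abs_nonneg _) (by positivity)

lemma integrable_truncProd_sq (N : ℕ) : Integrable (fun x => truncProd N x ^ 2) gaussMeasure := by
  simpa [sq] using integrable_truncProd_mul N 0

lemma truncMean_nonneg (N : ℕ) : 0 ≤ truncMean N := integral_nonneg (truncProd_nonneg N)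

lemma truncMean_sq_le (N : ℕ) : truncMean N ^ 2 ≤ truncSq N := by
  have h : 0 ≤ ∫ x, (truncProd N x - truncMean N) ^ 2 ∂gaussMeasure :=
    integral_nonneg fun x => sq_nonneg _
  have e : ∀ x, (truncProd N x - truncMean N) ^ 2 =
      truncProd N x ^ 2 - 2 * truncMean N * truncProd N x + truncMean N ^ 2 := fun x => by ring
  simp_rw [e] at h
  have i1 := (integrable_truncProd N).const_mul (2 * truncMean N)
  have i2 : Integrable (fun x => truncProd N x ^ 2 - 2 * truncMean N * truncProd N x)
    gaussMeasure := (integrable_truncProd_sq N).sub i1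
  rw [integral_add i2 (integrable_const _), integral_sub (integrable_truncProd_sq N) i1,
    integral_const_mul] at h
  simp only [integral_const, probReal_univ, one_smul] at h
  unfold truncSq
  change 0 ≤ _ - 2 * truncMean N * truncMean N + _ at h
  linarith

lemma integral_truncProd_mul_le (N n : ℕ) :
    ∫ x, truncProd N x * truncProd N (gaussMap^[n] x) ∂gaussMeasure ≤ truncSq N := by
  have hi := integrable_truncProd_sq N
  have hm : Measurable fun x => truncProd N x ^ 2 := (measurable_truncProd N).pow_const 2
  have hi' : Integrable (fun x => truncProd N (gaussMap^[n] x) ^ 2) gaussMeasure :=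
    integrable_comp_iterate (f := fun x => truncProd N x ^ 2) hi n
  have := integral_mono (μ := gaussMeasure) (integrable_truncProd_mul N n)
    ((hi.add hi').const_mul (1 / 2)) fun x => by
      simp only [Pi.add_apply]
      nlinarith [sq_nonneg (truncProd N x - truncProd N (gaussMap^[n] x))]
  rw [integral_const_mul] at this
  simp only [Pi.add_apply] at this
  rw [integral_add hi hi',
    integral_comp_iterate (f := fun x => truncProd N x ^ 2) hm n] at this
  unfold truncSq
  linarith

/-- Lags 0 and 1 involve overlapping digits and use only the second moment. From lag 2 on,
exponential decay applies, and `48 = 12 * 2 ^ 2` absorbs the shift of the exponent by two. -/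
lemma covariance_truncProd_le (N n : ℕ) :
    ∫ x, truncProd N x * truncProd N (gaussMap^[n] x) ∂gaussMeasure - truncMean N ^ 2 ≤
      48 * (1 / 2) ^ n * truncSq N := by
  have hQ : 0 ≤ truncSq N := (sq_nonneg _).trans (truncMean_sq_le N)
  have hE := sq_nonneg (truncMean N)
  match n with
  | 0 => linarith [integral_truncProd_mul_le N 0]
  | 1 => linarith [integral_truncProd_mul_le N 1]
  | n + 2 =>
    have := abs_integral_pair_mul_iterate_sub_le (truncPair_nonneg N)
      (fun k l h => truncPair_eq_zero k l h) (measurable_truncProd N) (truncProd_nonneg N)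
      (truncProd_le N) n
    have h2 := (le_abs_self _).trans this
    change ∫ x, truncProd N x * truncProd N (gaussMap^[n + 2] x) ∂gaussMeasure -
      truncMean N * truncMean N ≤ (1 / 2) ^ n * 12 * truncMean N * truncMean N at h2
    have h3 : (1 / 2 : ℝ) ^ n * 12 * truncMean N ^ 2 ≤ (1 / 2) ^ n * 12 * truncSq N :=
      mul_le_mul_of_nonneg_left (truncMean_sq_le N) (by positivity)
    rw [pow_add]
    linarith

lemma integral_truncProd_mul_truncSum (N n : ℕ) :
    ∫ x, truncProd N x * truncSum N n (gaussMap x) ∂gaussMeasure - n * truncMean N ^ 2 ≤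
      48 * truncSq N := by
  have hQ : 0 ≤ truncSq N := (sq_nonneg _).trans (truncMean_sq_le N)
  have e : ∀ x, truncProd N x * truncSum N n (gaussMap x) =
      ∑ i ∈ Finset.range n, truncProd N x * truncProd N (gaussMap^[i + 1] x) := by
    intro x
    simp only [truncSum, Finset.mul_sum, Function.iterate_succ_apply]
  simp_rw [e]
  rw [integral_finsetSum _ fun i _ => integrable_truncProd_mul N (i + 1)]
  have hc : (n : ℝ) * truncMean N ^ 2 = ∑ i ∈ Finset.range n, truncMean N ^ 2 := by simp
  rw [hc, ← Finset.sum_sub_distrib]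
  refine (Finset.sum_le_sum fun i _ => covariance_truncProd_le N (i + 1)).trans ?_
  rw [← Finset.sum_mul, ← Finset.mul_sum]
  have hg : ∑ i ∈ Finset.range n, (1 / 2 : ℝ) ^ (i + 1) ≤ 1 := by
    have : ∀ n : ℕ, ∑ i ∈ Finset.range n, (1 / 2 : ℝ) ^ (i + 1) = 1 - (1 / 2) ^ n := by
      intro n
      induction n with
      | zero => simp
      | succ n ih => rw [Finset.sum_range_succ, ih]; ring
    rw [this]
    have : (0 : ℝ) ≤ (1 / 2) ^ n := by positivity
    linarith
  gcongr
  linarith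

lemma integrable_truncSum (N n : ℕ) : Integrable (truncSum N n) gaussMeasure :=
  integrable_of_abs_le (C := n * N) (measurable_truncSum N n) fun x => by
    rw [abs_of_nonneg (truncSum_nonneg N n x)]
    exact truncSum_le N n x

lemma integral_truncSum (N n : ℕ) : ∫ x, truncSum N n x ∂gaussMeasure = n * truncMean N := by
  unfold truncSum
  rw [integral_finsetSum]
  · simp_rw [integral_comp_iterate (measurable_truncProd N)]
    simp [truncMean]
  · intro i _
    exact integrable_comp_iterate (f := truncProd N) (integrable_truncProd N) i

lemma integrable_mul_of_bound {f g : ℝ → ℝ} (hf : Measurable f) (hg : Measurable g) {C D : ℝ}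
    (hC : ∀ x, |f x| ≤ C) (hD : ∀ x, |g x| ≤ D) :
    Integrable (fun x => f x * g x) gaussMeasure := by
  refine integrable_of_abs_le (C := C * D) (hf.mul hg) fun x => ?_
  rw [abs_mul]
  exact mul_le_mul (hC x) (hD x) (abs_nonneg _) ((abs_nonneg _).trans (hC x))

lemma measurable_truncSum_sub (N n : ℕ) :
    Measurable fun x => truncSum N n x - n * truncMean N :=
  (measurable_truncSum N n).sub_const _

lemma abs_truncSum_sub_le (N n : ℕ) (x : ℝ) :
    |truncSum N n x - n * truncMean N| ≤ n * N + n * truncMean N := by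
  have h1 := truncSum_nonneg N n x
  have h2 := truncSum_le N n x
  have h3 : 0 ≤ n * truncMean N := mul_nonneg (by positivity) (truncMean_nonneg N)
  rw [abs_le]
  constructor <;> linarith

lemma integrable_truncSum_sub_sq (N n : ℕ) :
    Integrable (fun x => (truncSum N n x - n * truncMean N) ^ 2) gaussMeasure := by
  have := integrable_mul_of_bound (measurable_truncSum_sub N n) (measurable_truncSum_sub N n)
    (abs_truncSum_sub_le N n) (abs_truncSum_sub_le N n)
  simpa [sq] using this

/-- The variance of the truncated sums. -/
lemma variance_truncSum_le (N n : ℕ) :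
    ∫ x, (truncSum N n x - n * truncMean N) ^ 2 ∂gaussMeasure ≤ n * (97 * truncSq N) := by
  induction n with
  | zero => simp [truncSum]
  | succ n ih =>
    set E := truncMean N with hE
    -- Splitting off the first term leaves the Birkhoff sum at `gaussMap x`, so invariance
    -- reproduces the previous variance. Each step adds at most twice the summed covariances plus
    -- one second moment: `97 = 2 * 48 + 1`.
    have e : ∀ x, (truncSum N (n + 1) x - (n + 1 : ℕ) * E) ^ 2 =
        (truncSum N n (gaussMap x) - n * E) ^ 2 +
          (2 * (truncProd N x * truncSum N n (gaussMap x)) +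
            (truncProd N x ^ 2 + (-(2 * E) * truncSum N n (gaussMap x) +
              (-(2 * (n + 1) * E) * truncProd N x + (2 * n + 1) * E ^ 2)))) := by
      intro x
      rw [truncSum_succ]
      push_cast
      ring
    have hSm : Measurable fun x => truncSum N n (gaussMap x) :=
      (measurable_truncSum N n).comp measurable_gaussMap
    have hSi : Integrable (fun x => truncSum N n (gaussMap x)) gaussMeasure :=
      integrable_comp_gaussMap (f := truncSum N n) (integrable_truncSum N n)
    have hVi : Integrable (fun x => (truncSum N n (gaussMap x) - n * E) ^ 2) gaussMeasure :=
      integrable_comp_gaussMap (f := fun x => (truncSum N n x - n * E) ^ 2)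
        (integrable_truncSum_sub_sq N n)
    have hPS : Integrable (fun x => truncProd N x * truncSum N n (gaussMap x)) gaussMeasure :=
      integrable_mul_of_bound (measurable_truncProd N) hSm (abs_truncProd_le N)
        (D := n * N) fun x => by
          rw [abs_of_nonneg (truncSum_nonneg N n _)]
          exact truncSum_le N n _
    have i5 : Integrable (fun x => -(2 * (n + 1) * E) * truncProd N x + (2 * n + 1) * E ^ 2)
      gaussMeasure := ((integrable_truncProd N).const_mul _).add (integrable_const _)
    have i4 := (hSi.const_mul (-(2 * E))).fun_add i5
    have i3 := (integrable_truncProd_sq N).fun_add i4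
    have i2 := (hPS.const_mul 2).fun_add i3
    have key : ∫ x, (truncSum N (n + 1) x - (n + 1 : ℕ) * E) ^ 2 ∂gaussMeasure =
        ∫ x, (truncSum N n (gaussMap x) - n * E) ^ 2 ∂gaussMeasure +
          (2 * ∫ x, truncProd N x * truncSum N n (gaussMap x) ∂gaussMeasure +
            (truncSq N + (-(2 * E) * (n * E) +
              (-(2 * (n + 1) * E) * E + (2 * n + 1) * E ^ 2)))) := by
      simp_rw [e]
      rw [integral_add hVi i2, integral_add (hPS.const_mul 2) i3,
        integral_add (integrable_truncProd_sq N) i4, integral_add (hSi.const_mul _) i5,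
        integral_add ((integrable_truncProd N).const_mul _) (integrable_const _),
        integral_const_mul, integral_const_mul, integral_const_mul,
        integral_comp_gaussMap (f := truncSum N n) (measurable_truncSum N n), integral_truncSum]
      simp [truncSq, truncMean, hE]
    rw [key, integral_comp_gaussMap (f := fun x => (truncSum N n x - n * E) ^ 2)
      ((measurable_truncSum_sub N n).pow_const 2)]
    have h1 := integral_truncProd_mul_truncSum N n
    rw [← hE] at h1
    have h2 := sq_nonneg E
    push_cast
    nlinarith

/-! ### Harmonic sums and the truncated moments. -/

lemma sum_one_div_le (n : ℕ) :
    ∑ k ∈ Finset.range n, 1 / ((k : ℝ) + 1) ≤ 1 + Real.log n := by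
  have := harmonic_le_one_add_log n
  simpa [harmonic] using this

lemma log_sub_log_le_sum {c : ℝ} (hc : 0 ≤ c) (n : ℕ) :
    Real.log (n + 1 + c) - Real.log (1 + c) ≤ ∑ k ∈ Finset.range n, 1 / ((k : ℝ) + 1 + c) := by
  induction n with
  | zero => simp
  | succ n ih =>
    rw [Finset.sum_range_succ]
    have h1 : (0 : ℝ) < n + 1 + c := by positivity
    have h2 : (0 : ℝ) < (n + 1 : ℕ) + 1 + c := by positivity
    have h3 := Real.log_le_sub_one_of_pos (div_pos h2 h1)
    rw [Real.log_div h2.ne' h1.ne'] at h3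
    have h4 : (((n + 1 : ℕ) : ℝ) + 1 + c) / (n + 1 + c) - 1 = 1 / (n + 1 + c) := by
      push_cast
      field_simp
      ring
    linarith

lemma one_div_le_log_sub_log (n : ℕ) :
    1 / ((n : ℝ) + 2) ≤ Real.log (n + 2) - Real.log (n + 1) ∧
      Real.log (n + 2) - Real.log (n + 1) ≤ 1 / ((n : ℝ) + 1) := by
  have h1 : (0 : ℝ) < n + 1 := by positivity
  have h2 : (0 : ℝ) < n + 2 := by positivity
  rw [← Real.log_div h2.ne' h1.ne']
  constructor
  · refine le_trans (le_of_eq ?_) (Real.one_sub_inv_le_log_of_pos (div_pos h2 h1))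
    field_simp
    ring
  · refine (Real.log_le_sub_one_of_pos (div_pos h2 h1)).trans (le_of_eq ?_)
    field_simp
    ring

/-- Discrete form of `∫ log t / t = log² t / 2`. With `d` the increment of the logarithm, the
increment of the half square differs from the summand's main term by `d ^ 2 / 2 ≤ d / 2`, which
telescopes into the correction. The same argument gives `le_sum_log_div`. -/
lemma sum_log_div_le (n : ℕ) :
    ∑ k ∈ Finset.range (n + 1), Real.log (k + 1) / ((k : ℝ) + 1) ≤
      1 / 2 * Real.log (n + 1) ^ 2 + 1 / 2 * Real.log (n + 1) := by
  induction n with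
  | zero => simp
  | succ n ih =>
    rw [Finset.sum_range_succ]
    obtain ⟨h1, h2⟩ := one_div_le_log_sub_log n
    have h3 : (1 : ℝ) / (n + 1) ≤ 1 := by
      rw [div_le_one (by positivity)]
      linarith [(Nat.cast_nonneg n : (0 : ℝ) ≤ n)]
    have e : ((n + 1 : ℕ) : ℝ) + 1 = n + 2 := by push_cast; ring
    rw [e, div_eq_mul_one_div]
    have h4 : 0 ≤ Real.log ((n : ℝ) + 2) :=
      Real.log_nonneg (by linarith [(Nat.cast_nonneg n : (0 : ℝ) ≤ n)])
    have h5 : 0 ≤ (1 : ℝ) / (n + 2) := by positivity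
    nlinarith [mul_le_mul_of_nonneg_left h1 h4, mul_nonneg (h5.trans h1)
      (sub_nonneg.2 (h2.trans h3))]

lemma le_sum_log_div (n : ℕ) :
    1 / 2 * Real.log (n + 1) ^ 2 ≤
      ∑ k ∈ Finset.range n, Real.log (k + 1) / ((k : ℝ) + 1) + 1 / 2 * Real.log (n + 1) := by
  induction n with
  | zero => simp
  | succ n ih =>
    rw [Finset.sum_range_succ]
    obtain ⟨h1, h2⟩ := one_div_le_log_sub_log n
    have h3 : (1 : ℝ) / (n + 1) ≤ 1 := by
      rw [div_le_one (by positivity)]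
      linarith [(Nat.cast_nonneg n : (0 : ℝ) ≤ n)]
    have e : ((n + 1 : ℕ) : ℝ) + 1 = n + 2 := by push_cast; ring
    rw [e, div_eq_mul_one_div (Real.log _)]
    have h4 : 0 ≤ Real.log ((n : ℝ) + 1) :=
      Real.log_nonneg (by linarith [(Nat.cast_nonneg n : (0 : ℝ) ≤ n)])
    have h5 : 0 ≤ (1 : ℝ) / (n + 2) := by positivity
    nlinarith [mul_le_mul_of_nonneg_left h2 h4, mul_nonneg (h5.trans h1)
      (sub_nonneg.2 (h2.trans h3))]

lemma sum_hyperbola (N : ℕ) (c : ℕ → ℕ → ℝ) :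
    ∑ l ∈ Finset.range N, ∑ k ∈ Finset.range N,
        (if (k + 1) * (l + 1) ≤ N then c k l else 0) =
      ∑ l ∈ Finset.range N, ∑ k ∈ Finset.range (N / (l + 1)), c k l := by
  refine Finset.sum_congr rfl fun l _ => ?_
  rw [← Finset.sum_filter]
  refine Finset.sum_congr ?_ fun _ _ => rfl
  ext k
  simp only [Finset.mem_filter, Finset.mem_range]
  rw [← Nat.le_div_iff_mul_le (show 0 < l + 1 by omega)]
  have : N / (l + 1) ≤ N := Nat.div_le_self _ _
  omega

/-- The factor `1 + y` cancels the Gauss density; the `log 2` of the final constant enters here. -/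
lemma integral_one_add : ∫ y, (1 + y) ∂gaussMeasure = (Real.log 2)⁻¹ := by
  have hl : 0 < Real.log 2 := Real.log_pos (by norm_num)
  rw [integral_eq_lintegral_of_nonneg_ae, lintegral_gaussMeasure (by fun_prop)]
  · have : ∫⁻ x in Set.Ioo (0 : ℝ) 1, ENNReal.ofReal ((Real.log 2)⁻¹ / (1 + x)) *
        ENNReal.ofReal (1 + x) = ∫⁻ x in Set.Ioo (0 : ℝ) 1, ENNReal.ofReal ((Real.log 2)⁻¹) := by
      refine setLIntegral_congr_fun measurableSet_Ioo fun x hx => ?_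
      have : 0 < 1 + x := by linarith [hx.1]
      rw [← ENNReal.ofReal_mul (by positivity), div_mul_cancel₀ _ this.ne']
    rw [this]
    simp [hl.le]
  · filter_upwards [ae_gaussMeasure] with x hx
    simp only [Pi.zero_apply]
    linarith [hx.1]
  · fun_prop

lemma integrable_one_add_mul_pairKernel (k l : ℕ) :
    Integrable (fun y => (1 + y) * pairKernel k l y) gaussMeasure := by
  have hm := measurable_pairKernel k l
  refine integrable_of_mem_Icc (a := 0) (b := 2 * pairKernel k l 0) (by fun_prop) fun y hy => ?_
  have h1 := (pairKernel_pos k l hy.1).le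
  have h2 := antitoneOn_pairKernel k l (Set.left_mem_Icc.2 zero_le_one) hy hy.1
  constructor
  · exact mul_nonneg (by linarith [hy.1]) h1
  · exact mul_le_mul (by linarith [hy.2]) h2 h1 (by norm_num)

lemma integrable_one_add : Integrable (fun y : ℝ => 1 + y) gaussMeasure :=
  integrable_of_mem_Icc (a := 0) (b := 2) (by fun_prop) fun y hy =>
    ⟨by linarith [hy.1], by linarith [hy.2]⟩

lemma integral_pairKernel_le (k l : ℕ) :
    ∫ y, (1 + y) * pairKernel k l y ∂gaussMeasure ≤ (Real.log 2)⁻¹ * pairKernel k l 0 := by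
  rw [← integral_one_add, ← integral_mul_const]
  refine integral_mono_ae (integrable_one_add_mul_pairKernel k l)
    (integrable_one_add.mul_const _) ?_
  filter_upwards [ae_gaussMeasure] with y hy
  exact mul_le_mul_of_nonneg_left (antitoneOn_pairKernel k l (Set.left_mem_Icc.2 zero_le_one)
    ⟨hy.1.le, hy.2.le⟩ hy.1.le) (by linarith [hy.1])

lemma le_integral_pairKernel (k l : ℕ) :
    (Real.log 2)⁻¹ * pairKernel k l 1 ≤ ∫ y, (1 + y) * pairKernel k l y ∂gaussMeasure := by
  rw [← integral_one_add, ← integral_mul_const]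
  refine integral_mono_ae (integrable_one_add.mul_const _)
    (integrable_one_add_mul_pairKernel k l) ?_
  filter_upwards [ae_gaussMeasure] with y hy
  exact mul_le_mul_of_nonneg_left (antitoneOn_pairKernel k l ⟨hy.1.le, hy.2.le⟩
    (Set.right_mem_Icc.2 zero_le_one) hy.2.le) (by linarith [hy.1])

lemma integral_pair {φ : ℕ → ℕ → ℝ} (hφ : ∀ k l, 0 ≤ φ k l) {N : ℕ}
    (hN : ∀ k l, N < k * l → φ k l = 0) :
    ∫ x, φ (digit x) (digit (gaussMap x)) ∂gaussMeasure =
      ∑ l ∈ Finset.range N, ∑ k ∈ Finset.range N,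
        (∫ y, (1 + y) * pairKernel k l y ∂gaussMeasure) * φ (k + 1) (l + 1) := by
  have := integral_pair_mul hφ hN (ψ := fun _ => 1) measurable_const (fun _ => zero_le_one)
  simp only [mul_one] at this
  rw [this, integral_finsetSum]
  · refine Finset.sum_congr rfl fun l _ => ?_
    rw [integral_finsetSum]
    · exact Finset.sum_congr rfl fun k _ => integral_mul_const _ _
    · exact fun k _ => (integrable_one_add_mul_pairKernel k l).mul_const _
  · exact fun l _ => integrable_finsetSum _ fun k _ =>
      (integrable_one_add_mul_pairKernel k l).mul_const _

lemma log_two_inv_le : (Real.log 2)⁻¹ ≤ 2 := by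
  rw [inv_le_comm₀ (Real.log_pos (by norm_num)) (by norm_num)]
  linarith [Real.log_two_gt_d9]

/-- A cylinder has measure at most `(log 2)⁻¹` over the squared product of its digits, so the square
cancels and only the lattice points under the hyperbola are counted. -/
lemma truncSq_le (N : ℕ) : truncSq N ≤ 2 * (N * (1 + Real.log N)) := by
  have hl : 0 < (Real.log 2)⁻¹ := inv_pos.2 (Real.log_pos (by norm_num))
  have h := integral_pair (φ := fun k l => truncPair N k l ^ 2) (fun k l => sq_nonneg _)
    (N := N) (fun k l h => by simp [truncPair_eq_zero k l h])
  change truncSq N = _ at h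
  rw [h]
  have hterm : ∀ k l : ℕ, (∫ y, (1 + y) * pairKernel k l y ∂gaussMeasure) *
      truncPair N (k + 1) (l + 1) ^ 2 ≤ if (k + 1) * (l + 1) ≤ N then (Real.log 2)⁻¹ else 0 := by
    intro k l
    unfold truncPair
    split_ifs with hkl
    · have h1 := (integral_pairKernel_le k l).trans
        (mul_le_mul_of_nonneg_left (pairKernel_zero_le_inv k l) hl.le)
      refine (mul_le_mul_of_nonneg_right h1 (sq_nonneg _)).trans (le_of_eq ?_)
      push_cast
      field_simp
    · simp
  refine (Finset.sum_le_sum fun l _ => Finset.sum_le_sum fun k _ => hterm k l).trans ?_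
  rw [sum_hyperbola N fun _ _ => (Real.log 2)⁻¹]
  simp only [Finset.sum_const, Finset.card_range, nsmul_eq_mul]
  rw [← Finset.sum_mul, mul_comm]
  refine mul_le_mul log_two_inv_le ?_ (Finset.sum_nonneg fun _ _ => by positivity) (by norm_num)
  calc ∑ l ∈ Finset.range N, ((N / (l + 1) : ℕ) : ℝ)
      ≤ ∑ l ∈ Finset.range N, (N : ℝ) * (1 / ((l : ℝ) + 1)) := by
        refine Finset.sum_le_sum fun l _ => ?_
        refine Nat.cast_div_le.trans (le_of_eq ?_)
        push_cast
        ring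
    _ ≤ _ := by
        rw [← Finset.mul_sum]
        exact mul_le_mul_of_nonneg_left (sum_one_div_le N) (by positivity)

/-- After one cancellation the mean is at most a sum of `1 / (k l)` over `k l ≤ N`. Summing over `k`
gives `(log N - log l) / l` to leading order, and summing over `l` gives `log² N - log² N / 2`. -/
lemma truncMean_le {N : ℕ} (hN : 1 ≤ N) :
    Real.log 2 * truncMean N ≤ 1 / 2 * Real.log N ^ 2 + 6 * (1 + Real.log N) := by
  have hl : 0 < Real.log 2 := Real.log_pos (by norm_num)
  have hN' : (1 : ℝ) ≤ N := by exact_mod_cast hN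
  have hL : 0 ≤ Real.log N := Real.log_nonneg hN'
  have h := integral_pair (truncPair_nonneg N) (N := N) (fun k l h => truncPair_eq_zero k l h)
  change truncMean N = _ at h
  have hterm : ∀ k l : ℕ, Real.log 2 * ((∫ y, (1 + y) * pairKernel k l y ∂gaussMeasure) *
      truncPair N (k + 1) (l + 1)) ≤
        if (k + 1) * (l + 1) ≤ N then 1 / ((l : ℝ) + 1) * (1 / ((k : ℝ) + 1)) else 0 := by
    intro k l
    unfold truncPair
    split_ifs with hkl
    · have h1 := (integral_pairKernel_le k l).trans
        (mul_le_mul_of_nonneg_left (pairKernel_zero_le_inv k l) (inv_nonneg.2 hl.le))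
      refine (mul_le_mul_of_nonneg_left (mul_le_mul_of_nonneg_right h1 (by positivity))
        hl.le).trans (le_of_eq ?_)
      push_cast
      field_simp
    · simp
  have h2 : Real.log 2 * truncMean N ≤
      ∑ l ∈ Finset.range N, ∑ k ∈ Finset.range (N / (l + 1)),
        1 / ((l : ℝ) + 1) * (1 / ((k : ℝ) + 1)) := by
    rw [← sum_hyperbola N fun k l => 1 / ((l : ℝ) + 1) * (1 / ((k : ℝ) + 1)), h]
    simp only [Finset.mul_sum]
    exact Finset.sum_le_sum fun l _ => Finset.sum_le_sum fun k _ => hterm k l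
  have h3 : ∀ l ∈ Finset.range N, ∑ k ∈ Finset.range (N / (l + 1)),
      1 / ((l : ℝ) + 1) * (1 / ((k : ℝ) + 1)) ≤
        (1 + Real.log N) * (1 / ((l : ℝ) + 1)) - Real.log (l + 1) / ((l : ℝ) + 1) := by
    intro l hl
    have hlN : l + 1 ≤ N := Finset.mem_range.1 hl
    have hd : 1 ≤ N / (l + 1) := (Nat.one_le_div_iff (Nat.succ_pos l)).2 hlN
    rw [← Finset.mul_sum]
    have h4 : Real.log ((N / (l + 1) : ℕ) : ℝ) ≤ Real.log N - Real.log (l + 1) := by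
      rw [← Real.log_div (by positivity) (by positivity)]
      refine Real.log_le_log (by exact_mod_cast hd) (Nat.cast_div_le.trans (le_of_eq ?_))
      push_cast
      ring
    have h5 := mul_le_mul_of_nonneg_left ((sum_one_div_le (N / (l + 1))).trans
      (add_le_add_right h4 1)) (show (0 : ℝ) ≤ 1 / ((l : ℝ) + 1) by positivity)
    refine h5.trans (le_of_eq ?_)
    ring
  have h6 := Finset.sum_le_sum h3
  rw [Finset.sum_sub_distrib, ← Finset.mul_sum] at h6
  have h7 := mul_le_mul_of_nonneg_left (sum_one_div_le N) (show 0 ≤ 1 + Real.log N by positivity)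
  have h8 := le_sum_log_div N
  have h9 : Real.log N ≤ Real.log (N + 1) := Real.log_le_log (by positivity) (by linarith)
  have h10 : Real.log (N + 1) ≤ Real.log N + 1 := by
    have := Real.log_le_sub_one_of_pos (show (0 : ℝ) < (N + 1) / N by positivity)
    rw [Real.log_div (by positivity) (by positivity)] at this
    have e : ((N : ℝ) + 1) / N - 1 = 1 / N := by field_simp; ring
    have : 1 / (N : ℝ) ≤ 1 := by rw [div_le_one (by positivity)]; exact hN'
    linarith
  nlinarith

/-- The same hyperbola sum with denominators shifted by constants, which costs only `O(1 + log N)`.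
-/
lemma le_truncMean {N : ℕ} (hN : 1 ≤ N) :
    1 / 2 * Real.log N ^ 2 - 6 * (1 + Real.log N) ≤ Real.log 2 * truncMean N := by
  have hl : 0 < Real.log 2 := Real.log_pos (by norm_num)
  have hN' : (1 : ℝ) ≤ N := by exact_mod_cast hN
  have hL : 0 ≤ Real.log N := Real.log_nonneg hN'
  have h := integral_pair (truncPair_nonneg N) (N := N) (fun k l h => truncPair_eq_zero k l h)
  change truncMean N = _ at h
  have hterm : ∀ k l : ℕ,
      (if (k + 1) * (l + 1) ≤ N then 1 / ((l : ℝ) + 9) * (1 / ((k : ℝ) + 4)) else 0) ≤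
        Real.log 2 * ((∫ y, (1 + y) * pairKernel k l y ∂gaussMeasure) *
          truncPair N (k + 1) (l + 1)) := by
    intro k l
    unfold truncPair
    split_ifs with hkl
    · have h1 := (mul_le_mul_of_nonneg_left (le_pairKernel_one k l) (inv_nonneg.2 hl.le)).trans
        (le_integral_pairKernel k l)
      refine le_trans (le_of_eq ?_) (mul_le_mul_of_nonneg_left
        (mul_le_mul_of_nonneg_right h1 (by positivity)) hl.le)
      push_cast
      field_simp
    · simp
  have h2 : ∑ l ∈ Finset.range N, ∑ k ∈ Finset.range (N / (l + 1)),
      1 / ((l : ℝ) + 9) * (1 / ((k : ℝ) + 4)) ≤ Real.log 2 * truncMean N := by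
    rw [← sum_hyperbola N fun k l => 1 / ((l : ℝ) + 9) * (1 / ((k : ℝ) + 4)), h]
    simp only [Finset.mul_sum]
    exact Finset.sum_le_sum fun l _ => Finset.sum_le_sum fun k _ => hterm k l
  have hlog2 := Real.log_two_lt_d9
  have hlog4 : Real.log 4 ≤ 2 := by
    rw [show (4 : ℝ) = 2 ^ 2 by norm_num, Real.log_pow]
    push_cast
    linarith
  have hlog9 : Real.log 9 ≤ 3 := by
    have : Real.log 9 ≤ Real.log (2 ^ 4) := Real.log_le_log (by norm_num) (by norm_num)
    rw [Real.log_pow] at this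
    push_cast at this
    linarith
  have h3 : ∀ l ∈ Finset.range N,
      (Real.log N) * (1 / ((l : ℝ) + 9)) - Real.log (l + 1) / ((l : ℝ) + 1) -
        2 * (1 / ((l : ℝ) + 1)) ≤
      ∑ k ∈ Finset.range (N / (l + 1)), 1 / ((l : ℝ) + 9) * (1 / ((k : ℝ) + 4)) := by
    intro l _
    rw [← Finset.mul_sum]
    have h4 := log_sub_log_le_sum (c := 3) (by norm_num) (N / (l + 1))
    have e : ∀ k : ℕ, (k : ℝ) + 1 + 3 = k + 4 := fun k => by ring
    simp only [e] at h4
    rw [show (1 : ℝ) + 3 = 4 by norm_num] at h4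
    have h5 : Real.log N - Real.log (l + 1) ≤ Real.log ((N / (l + 1) : ℕ) + 4) := by
      rw [← Real.log_div (by positivity) (by positivity)]
      refine Real.log_le_log (by positivity) ?_
      rw [div_le_iff₀ (by positivity)]
      have := Nat.lt_div_mul_add (a := N) (Nat.succ_pos l)
      have h6 : (N : ℝ) ≤ (N / (l + 1) : ℕ) * (l + 1) + (l + 1) := by exact_mod_cast this.le
      have h7 : (0 : ℝ) ≤ l := by positivity
      nlinarith
    have h8 : Real.log N - Real.log (l + 1) - 2 ≤
        ∑ k ∈ Finset.range (N / (l + 1)), 1 / ((k : ℝ) + 4) := by linarith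
    have h9 : 0 ≤ 1 / ((l : ℝ) + 9) := by positivity
    refine le_trans ?_ (mul_le_mul_of_nonneg_left h8 h9)
    have h10 : 0 ≤ Real.log ((l : ℝ) + 1) :=
      Real.log_nonneg (by linarith [(Nat.cast_nonneg l : (0 : ℝ) ≤ l)])
    have h11 : 1 / ((l : ℝ) + 9) ≤ 1 / ((l : ℝ) + 1) :=
      one_div_le_one_div_of_le (by positivity) (by linarith)
    rw [div_eq_mul_one_div (Real.log ((l : ℝ) + 1))]
    nlinarith [mul_le_mul_of_nonneg_left h11 h10]
  have h6 := (Finset.sum_le_sum h3).trans h2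
  rw [Finset.sum_sub_distrib, Finset.sum_sub_distrib, ← Finset.mul_sum, ← Finset.mul_sum] at h6
  have h7 := log_sub_log_le_sum (c := 8) (by norm_num) N
  have e : ∀ k : ℕ, (k : ℝ) + 1 + 8 = k + 9 := fun k => by ring
  simp only [e] at h7
  rw [show (1 : ℝ) + 8 = 9 by norm_num] at h7
  have h8 : Real.log N ≤ Real.log (N + 9) := Real.log_le_log (by positivity) (by linarith)
  have h9 : Real.log N - 3 ≤ ∑ k ∈ Finset.range N, 1 / ((k : ℝ) + 9) := by linarith
  have h10 := mul_le_mul_of_nonneg_left h9 hL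
  have h11 := sum_one_div_le N
  obtain ⟨M, rfl⟩ : ∃ M, N = M + 1 := ⟨N - 1, by omega⟩
  have h12 := sum_log_div_le M
  rw [← Nat.cast_add_one] at h12
  nlinarith

/-! ### Large products and pairs of large products. -/

/-- The set where the product of the first two digits exceeds `N`. -/
def exceedSet (N : ℕ) : Set ℝ := {x | N < digit x * digit (gaussMap x)}

lemma measurableSet_exceedSet (N : ℕ) : MeasurableSet (exceedSet N) :=
  measurableSet_lt measurable_const (measurable_pair fun k l => k * l)

lemma measurableSet_le_digit (t : ℕ) : MeasurableSet {x | t ≤ digit x} :=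
  measurableSet_le measurable_const measurable_digit

lemma measurableSet_digit_eq (t : ℕ) : MeasurableSet {x | digit x = t} :=
  measurableSet_eq_fun measurable_digit measurable_const

/-- A uniform bound on the transferred indicator of `A` bounds the probability of `A` conditionally
on the future; iterating it handles several digits in succession. -/
lemma measure_inter_preimage_le {A B : Set ℝ} (hA : MeasurableSet A) (hB : MeasurableSet B)
    {c : ENNReal} (hc : ∀ y ∈ Set.Ioo (0 : ℝ) 1, transfer (A.indicator 1) y ≤ c) :
    gaussMeasure (A ∩ gaussMap ⁻¹' B) ≤ c * gaussMeasure B := by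
  have h1 : gaussMeasure (A ∩ gaussMap ⁻¹' B) =
      ∫⁻ x, A.indicator 1 x * B.indicator 1 (gaussMap x) ∂gaussMeasure := by
    rw [← lintegral_indicator_one (hA.inter (measurable_gaussMap hB))]
    refine lintegral_congr fun x => ?_
    by_cases ha : x ∈ A <;> by_cases hb : gaussMap x ∈ B <;> simp [ha, hb]
  rw [h1, lintegral_mul_comp_gaussMap (measurable_one.indicator hA) (measurable_one.indicator hB),
    ← lintegral_indicator_one hB, ← lintegral_const_mul _ (measurable_one.indicator hB)]
  refine lintegral_mono_ae ?_
  filter_upwards [ae_gaussMeasure] with y hy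
  gcongr
  exact hc y hy

lemma measure_le_digit_inter_le (m : ℕ) {B : Set ℝ} (hB : MeasurableSet B) :
    gaussMeasure ({x | m + 1 ≤ digit x} ∩ gaussMap ⁻¹' B) ≤
      ENNReal.ofReal (2 / ((m : ℝ) + 1)) * gaussMeasure B := by
  refine measure_inter_preimage_le (measurableSet_le_digit _) hB fun y hy => ?_
  have hs : HasSum (fun k : ℕ => if m ≤ k then branchWeight k y else 0)
      ((1 + y) / (m + 1 + y)) := by
    have := hasSum_branchWeight_tail m hy.1.le
    have h2 := (hasSum_nat_add_iff (f := fun k : ℕ => if m ≤ k then branchWeight k y else 0) m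
      (g := (1 + y) / (m + 1 + y))).1 (by simpa using this)
    rwa [Finset.sum_eq_zero, add_zero] at h2
    intro k hk
    rw [if_neg (by simpa using hk)]
  have hnn : ∀ k : ℕ, 0 ≤ if m ≤ k then branchWeight k y else 0 := fun k => by
    split_ifs
    · exact branchWeight_nonneg k hy.1.le
    · exact le_rfl
  have e : transfer ({x | m + 1 ≤ digit x}.indicator 1) y =
      ENNReal.ofReal ((1 + y) / (m + 1 + y)) := by
    rw [← hs.tsum_eq, ENNReal.ofReal_tsum_of_nonneg hnn hs.summable]
    refine tsum_congr fun k => ?_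
    have := digit_branch k ⟨hy.1.le, hy.2⟩
    by_cases hk : m ≤ k
    · rw [Set.indicator_of_mem (by simp only [Set.mem_ofPred_eq]; omega), if_pos hk, Pi.one_apply,
        mul_one]
    · rw [Set.indicator_of_notMem (by simp only [Set.mem_ofPred_eq]; omega), if_neg hk, mul_zero,
        ENNReal.ofReal_zero]
  rw [e]
  refine ENNReal.ofReal_le_ofReal ?_
  have hy0 := hy.1
  exact div_le_div₀ (by norm_num) (by linarith [hy.2]) (by positivity) (by linarith)

lemma measure_le_digit_le (m : ℕ) :
    gaussMeasure {x | m + 1 ≤ digit x} ≤ ENNReal.ofReal (2 / ((m : ℝ) + 1)) := by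
  simpa using measure_le_digit_inter_le m MeasurableSet.univ

lemma measure_digit_eq_inter_le (m : ℕ) {B : Set ℝ} (hB : MeasurableSet B) :
    gaussMeasure ({x | digit x = m + 1} ∩ gaussMap ⁻¹' B) ≤
      ENNReal.ofReal (2 / ((m : ℝ) + 1) ^ 2) * gaussMeasure B := by
  refine measure_inter_preimage_le (measurableSet_digit_eq _) hB fun y hy => ?_
  have e : transfer ({x | digit x = m + 1}.indicator 1) y = ENNReal.ofReal (branchWeight m y) := by
    unfold transfer
    rw [tsum_eq_single m]
    · have := digit_branch m ⟨hy.1.le, hy.2⟩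
      rw [Set.indicator_of_mem (by simpa only [Set.mem_ofPred_eq]), Pi.one_apply, mul_one]
    · intro k hk
      have := digit_branch k ⟨hy.1.le, hy.2⟩
      rw [Set.indicator_of_notMem (by simp only [Set.mem_ofPred_eq]; omega), mul_zero]
  rw [e]
  refine ENNReal.ofReal_le_ofReal ?_
  have hy0 := hy.1
  unfold branchWeight
  refine div_le_div₀ (by norm_num) (by linarith [hy.2]) (by positivity) ?_
  rw [sq]
  exact mul_le_mul (by linarith) (by linarith) (by positivity) (by positivity)

lemma two_div_le {N k : ℕ} (hN : 1 ≤ N) :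
    2 / (((N / (k + 1) : ℕ) : ℝ) + 1) ≤ 2 * ((k : ℝ) + 1) / N := by
  have hN' : (0 : ℝ) < N := by exact_mod_cast hN
  rw [div_le_div_iff₀ (by positivity) hN']
  have := Nat.lt_div_mul_add (a := N) (show 0 < k + 1 by omega)
  have h6 : (N : ℝ) ≤ (N / (k + 1) : ℕ) * (k + 1) + (k + 1) := by exact_mod_cast this.le
  nlinarith

lemma div_add_one_le_of_lt_mul {N k l : ℕ} (h : N < (k + 1) * l) : N / (k + 1) + 1 ≤ l :=
  (Nat.div_lt_iff_lt_mul (show 0 < k + 1 by omega)).2 (by rwa [mul_comm])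

/-- Either the first digit exceeds `N`, or it equals some `k + 1 ≤ N` and the second exceeds `N / (k
+ 1)`. The latter has probability at most `4 / (N (k + 1))`, and the harmonic sum produces the
logarithm. -/
lemma measure_exceedSet_le {N : ℕ} (hN : 1 ≤ N) :
    gaussMeasure (exceedSet N) ≤ ENNReal.ofReal (6 * (1 + Real.log N) / N) := by
  have hN' : (0 : ℝ) < N := by exact_mod_cast hN
  have hsub : exceedSet N ⊆ {x | N + 1 ≤ digit x} ∪ ⋃ k ∈ Finset.range N,
      ({x | digit x = k + 1} ∩ gaussMap ⁻¹' {x | N / (k + 1) + 1 ≤ digit x}) := by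
    intro x hx
    have hx' : N < digit x * digit (gaussMap x) := hx
    by_cases h : N + 1 ≤ digit x
    · exact Or.inl h
    · obtain ⟨k, hk⟩ : ∃ k, digit x = k + 1 := Nat.exists_eq_succ_of_ne_zero (by
        intro h0
        simp [h0] at hx')
      rw [hk] at hx'
      refine Or.inr (Set.mem_biUnion (x := k) (Finset.mem_coe.2 (Finset.mem_range.2 (by omega)))
        ⟨hk, div_add_one_le_of_lt_mul hx'⟩)
  refine (measure_mono hsub).trans ((measure_union_le _ _).trans ?_)
  have h1 : gaussMeasure (⋃ k ∈ Finset.range N,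
      ({x | digit x = k + 1} ∩ gaussMap ⁻¹' {x | N / (k + 1) + 1 ≤ digit x})) ≤
      ∑ k ∈ Finset.range N, ENNReal.ofReal (4 / N * (1 / ((k : ℝ) + 1))) := by
    refine (measure_biUnion_finset_le _ _).trans (Finset.sum_le_sum fun k _ => ?_)
    refine (measure_digit_eq_inter_le k (measurableSet_le_digit _)).trans ?_
    refine (mul_le_mul_right (measure_le_digit_le _) _).trans ?_
    rw [← ENNReal.ofReal_mul (by positivity)]
    refine ENNReal.ofReal_le_ofReal ?_
    refine (mul_le_mul_of_nonneg_left (two_div_le hN) (by positivity)).trans (le_of_eq ?_)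
    field_simp
    norm_num
  refine (add_le_add (measure_le_digit_le N) h1).trans ?_
  rw [← ENNReal.ofReal_sum_of_nonneg fun _ _ => by positivity,
    ← ENNReal.ofReal_add (by positivity) (Finset.sum_nonneg fun _ _ => by positivity)]
  refine ENNReal.ofReal_le_ofReal ?_
  rw [← Finset.mul_sum]
  have h2 := mul_le_mul_of_nonneg_left (sum_one_div_le N) (show (0 : ℝ) ≤ 4 / N by positivity)
  have h3 : 2 / ((N : ℝ) + 1) ≤ 2 / N := div_le_div_of_nonneg_left (by norm_num) hN' (by linarith)
  have h4 : 0 ≤ Real.log N / N :=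
    div_nonneg (Real.log_nonneg (by exact_mod_cast hN)) hN'.le
  calc _ ≤ 2 / (N : ℝ) + 4 / N * (1 + Real.log N) := add_le_add h3 h2
    _ ≤ 2 / (N : ℝ) + 4 / N * (1 + Real.log N) + 2 * (Real.log N / N) := by linarith
    _ = _ := by ring

/-- Adjacent products share the middle digit. If it exceeds `N`, that alone costs `2 / N`; if it is
`k + 1 ≤ N`, both neighbours must exceed `N / (k + 1)`, and the powers of `k + 1` cancel to `8 / N ^
2` for each of the `N` values. -/
lemma measure_exceedSet_inter_preimage_le {N : ℕ} (hN : 1 ≤ N) :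
    gaussMeasure (exceedSet N ∩ gaussMap ⁻¹' exceedSet N) ≤ ENNReal.ofReal (10 / N) := by
  have hN' : (0 : ℝ) < N := by exact_mod_cast hN
  have hsub : exceedSet N ∩ gaussMap ⁻¹' exceedSet N ⊆
      gaussMap ⁻¹' {x | N + 1 ≤ digit x} ∪ ⋃ k ∈ Finset.range N,
      ({x | N / (k + 1) + 1 ≤ digit x} ∩ gaussMap ⁻¹'
        ({x | digit x = k + 1} ∩ gaussMap ⁻¹' {x | N / (k + 1) + 1 ≤ digit x})) := by
    rintro x ⟨hx, hy⟩
    have hx' : N < digit x * digit (gaussMap x) := hx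
    have hy' : N < digit (gaussMap x) * digit (gaussMap (gaussMap x)) := hy
    by_cases h : N + 1 ≤ digit (gaussMap x)
    · exact Or.inl h
    · obtain ⟨k, hk⟩ : ∃ k, digit (gaussMap x) = k + 1 := Nat.exists_eq_succ_of_ne_zero (by
        intro h0
        simp [h0] at hx')
      rw [hk] at hx' hy'
      rw [mul_comm] at hx'
      exact Or.inr (Set.mem_biUnion (x := k) (Finset.mem_coe.2 (Finset.mem_range.2 (by omega)))
        ⟨div_add_one_le_of_lt_mul hx', hk, div_add_one_le_of_lt_mul hy'⟩)
  refine (measure_mono hsub).trans ((measure_union_le _ _).trans ?_)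
  rw [measurePreserving_gaussMap.measure_preimage (measurableSet_le_digit _).nullMeasurableSet]
  have h1 : gaussMeasure (⋃ k ∈ Finset.range N,
      ({x | N / (k + 1) + 1 ≤ digit x} ∩ gaussMap ⁻¹'
        ({x | digit x = k + 1} ∩ gaussMap ⁻¹' {x | N / (k + 1) + 1 ≤ digit x}))) ≤
      ∑ k ∈ Finset.range N, ENNReal.ofReal (8 / (N : ℝ) ^ 2) := by
    refine (measure_biUnion_finset_le _ _).trans (Finset.sum_le_sum fun k _ => ?_)
    refine (measure_le_digit_inter_le _ ((measurableSet_digit_eq _).inter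
      (measurable_gaussMap (measurableSet_le_digit _)))).trans ?_
    refine (mul_le_mul_right ((measure_digit_eq_inter_le k (measurableSet_le_digit _)).trans
      (mul_le_mul_right (measure_le_digit_le _) _)) _).trans ?_
    rw [← ENNReal.ofReal_mul (by positivity), ← ENNReal.ofReal_mul (by positivity)]
    refine ENNReal.ofReal_le_ofReal ?_
    have h2 := two_div_le (k := k) hN
    calc _ ≤ 2 * ((k : ℝ) + 1) / N * (2 / ((k : ℝ) + 1) ^ 2 * (2 * ((k : ℝ) + 1) / N)) := by
          gcongr
      _ = _ := by field_simp; norm_num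
  refine (add_le_add (measure_le_digit_le N) h1).trans ?_
  rw [← ENNReal.ofReal_sum_of_nonneg fun _ _ => by positivity,
    ← ENNReal.ofReal_add (by positivity) (Finset.sum_nonneg fun _ _ => by positivity)]
  refine ENNReal.ofReal_le_ofReal ?_
  simp only [Finset.sum_const, Finset.card_range, nsmul_eq_mul]
  have h3 : 2 / ((N : ℝ) + 1) ≤ 2 / N := div_le_div_of_nonneg_left (by norm_num) hN' (by linarith)
  calc _ ≤ 2 / (N : ℝ) + N * (8 / (N : ℝ) ^ 2) := by linarith
    _ = _ := by field_simp; norm_num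

/-- Products at distance at least two share no digit, so quasi-independence suffices; no decay in
`n` is needed. -/
lemma measure_exceedSet_inter_iterate_le (N n : ℕ) :
    gaussMeasure (exceedSet N ∩ gaussMap^[n + 2] ⁻¹' exceedSet N) ≤
      8 * gaussMeasure (exceedSet N) ^ 2 := by
  set Φ : ℕ → ℕ → ENNReal := fun k l => if N < k * l then 1 else 0 with hΦ
  have hΦe : ∀ x, Φ (digit x) (digit (gaussMap x)) = (exceedSet N).indicator 1 x := by
    intro x
    simp only [hΦ, Set.indicator_apply, exceedSet, Set.mem_ofPred_eq, Pi.one_apply]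
  have hm := measurableSet_exceedSet N
  have hmn : MeasurableSet (gaussMap^[n] ⁻¹' exceedSet N) := (measurable_gaussMap.iterate n) hm
  have h := lintegral_pair_mul_le Φ (g := (gaussMap^[n] ⁻¹' exceedSet N).indicator 1)
    (measurable_one.indicator hmn)
  simp_rw [hΦe] at h
  rw [lintegral_indicator_one hm, lintegral_indicator_one hmn,
    (measurePreserving_iterate n).measure_preimage hm.nullMeasurableSet, mul_assoc, ← sq] at h
  refine le_trans (le_of_eq ?_) h
  rw [← lintegral_indicator_one (hm.inter (measurable_gaussMap.iterate (n + 2) hm))]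
  refine lintegral_congr fun x => ?_
  by_cases ha : x ∈ exceedSet N <;> by_cases hb : gaussMap^[n] (gaussMap (gaussMap x)) ∈ exceedSet N
    <;> simp [ha, hb]

/-- The set where at least two of the first `n` products of consecutive digits exceed `N`. -/
def doubleExceedSet (N n : ℕ) : Set ℝ :=
  {x | ∃ i j, i < j ∧ j < n ∧ gaussMap^[i] x ∈ exceedSet N ∧ gaussMap^[j] x ∈ exceedSet N}

lemma measure_doubleExceedSet_le {N : ℕ} (hN : 1 ≤ N) (n : ℕ) :
    gaussMeasure (doubleExceedSet N n) ≤
      ENNReal.ofReal (n * (10 / N) + n ^ 2 * (8 * (6 * (1 + Real.log N) / N) ^ 2)) := by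
  have hL : 0 ≤ Real.log N := Real.log_nonneg (by exact_mod_cast hN)
  have hm := measurableSet_exceedSet N
  have hsub : doubleExceedSet N n ⊆
      (⋃ i ∈ Finset.range n, gaussMap^[i] ⁻¹' (exceedSet N ∩ gaussMap ⁻¹' exceedSet N)) ∪
      ⋃ i ∈ Finset.range n, ⋃ j ∈ Finset.range n,
        gaussMap^[i] ⁻¹' (exceedSet N ∩ gaussMap^[j + 2] ⁻¹' exceedSet N) := by
    rintro x ⟨i, j, hij, hj, hi1, hj1⟩
    by_cases h : j = i + 1
    · refine Or.inl (Set.mem_biUnion (x := i) (Finset.mem_coe.2 (Finset.mem_range.2 (by omega)))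
        ⟨hi1, ?_⟩)
      rw [h, Function.iterate_succ_apply'] at hj1
      exact hj1
    · obtain ⟨d, rfl⟩ : ∃ d, j = (d + 2) + i := ⟨j - i - 2, by omega⟩
      refine Or.inr (Set.mem_biUnion (x := i) (Finset.mem_coe.2 (Finset.mem_range.2 (by omega)))
        (Set.mem_biUnion (x := d) (Finset.mem_coe.2 (Finset.mem_range.2 (by omega))) ⟨hi1, ?_⟩))
      rw [Function.iterate_add_apply] at hj1
      exact hj1
  refine (measure_mono hsub).trans ((measure_union_le _ _).trans ?_)
  have h1 : gaussMeasure (⋃ i ∈ Finset.range n,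
      gaussMap^[i] ⁻¹' (exceedSet N ∩ gaussMap ⁻¹' exceedSet N)) ≤
      ∑ i ∈ Finset.range n, ENNReal.ofReal (10 / N) := by
    refine (measure_biUnion_finset_le _ _).trans (Finset.sum_le_sum fun i _ => ?_)
    rw [(measurePreserving_iterate i).measure_preimage
      (hm.inter (measurable_gaussMap hm)).nullMeasurableSet]
    exact measure_exceedSet_inter_preimage_le hN
  have h2 : gaussMeasure (⋃ i ∈ Finset.range n, ⋃ j ∈ Finset.range n,
      gaussMap^[i] ⁻¹' (exceedSet N ∩ gaussMap^[j + 2] ⁻¹' exceedSet N)) ≤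
      ∑ i ∈ Finset.range n, ∑ j ∈ Finset.range n,
        ENNReal.ofReal (8 * (6 * (1 + Real.log N) / N) ^ 2) := by
    refine (measure_biUnion_finset_le _ _).trans (Finset.sum_le_sum fun i _ => ?_)
    refine (measure_biUnion_finset_le _ _).trans (Finset.sum_le_sum fun j _ => ?_)
    rw [(measurePreserving_iterate i).measure_preimage
      (hm.inter (measurable_gaussMap.iterate (j + 2) hm)).nullMeasurableSet]
    refine (measure_exceedSet_inter_iterate_le N j).trans ?_
    rw [ENNReal.ofReal_mul (by norm_num), ENNReal.ofReal_pow (by positivity)]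
    norm_num only [ENNReal.ofReal_ofNat]
    gcongr
    exact measure_exceedSet_le hN
  refine (add_le_add h1 h2).trans (le_of_eq ?_)
  simp only [Finset.sum_const, Finset.card_range, nsmul_eq_mul]
  have hc : 0 ≤ 8 * (6 * (1 + Real.log N) / N) ^ 2 := by positivity
  generalize 8 * (6 * (1 + Real.log N) / N) ^ 2 = c at hc ⊢
  rw [ENNReal.ofReal_add (by positivity) (by positivity), ENNReal.ofReal_mul (by positivity),
    ENNReal.ofReal_mul (by positivity), ENNReal.ofReal_pow (by positivity),
    ENNReal.ofReal_natCast, sq, mul_assoc]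

/-! ### From moments to pointwise statements; trimming versus truncation. -/

/-- The sum of the squares has finite expectation, hence is finite almost everywhere, and its terms
tend to zero. -/
lemma ae_tendsto_zero_of_summable_integral_sq {Z : ℕ → ℝ → ℝ}
    (hZ : ∀ m, Measurable (Z m)) (hi : ∀ m, Integrable (fun x => Z m x ^ 2) gaussMeasure)
    (hs : Summable fun m => ∫ x, Z m x ^ 2 ∂gaussMeasure) :
    ∀ᵐ x ∂gaussMeasure, Tendsto (fun m => Z m x) atTop (𝓝 0) := by
  have hm : ∀ m, Measurable fun x => ENNReal.ofReal (Z m x ^ 2) := fun m =>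
    ((hZ m).pow_const 2).ennreal_ofReal
  have h1 : ∫⁻ x, ∑' m, ENNReal.ofReal (Z m x ^ 2) ∂gaussMeasure ≠ ⊤ := by
    rw [lintegral_tsum fun m => (hm m).aemeasurable]
    have : ∀ m, ∫⁻ x, ENNReal.ofReal (Z m x ^ 2) ∂gaussMeasure =
        ENNReal.ofReal (∫ x, Z m x ^ 2 ∂gaussMeasure) := fun m =>
      (ofReal_integral_eq_lintegral_ofReal (hi m) (ae_of_all _ fun x => sq_nonneg _)).symm
    simp_rw [this]
    exact hs.tsum_ofReal_ne_top
  filter_upwards [ae_lt_top (Measurable.tsum hm) h1] with x hx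
  have h2 := ENNReal.tendsto_atTop_zero_of_tsum_ne_top hx.ne
  have h3 := (ENNReal.tendsto_toReal ENNReal.zero_ne_top).comp h2
  have h4 : Tendsto (fun m => Z m x ^ 2) atTop (𝓝 0) := by
    refine h3.congr fun m => ?_
    simp only [Function.comp_apply]
    exact ENNReal.toReal_ofReal (sq_nonneg _)
  have h5 := h4.sqrt
  simp only [Real.sqrt_sq_eq_abs, Real.sqrt_zero] at h5
  exact (tendsto_zero_iff_abs_tendsto_zero _).2 h5

/-- If at most one of `Y 0, …, Y (n - 1)` exceeds `N`, then their sum without the largest is close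
to the sum truncated at `N`. -/
lemma sum_sub_sup_bounds (Y : ℕ → ℕ) (N n : ℕ)
    (h : ∀ i j, i < j → j < n → N < Y i → ¬ N < Y j) :
    (∑ i ∈ Finset.range n, if Y i ≤ N then Y i else 0) + (Finset.range n).sup Y ≤
        ∑ i ∈ Finset.range n, Y i + N ∧
      ∑ i ∈ Finset.range n, Y i ≤
        (∑ i ∈ Finset.range n, if Y i ≤ N then Y i else 0) + (Finset.range n).sup Y := by
  by_cases hex : ∃ i < n, N < Y i
  · obtain ⟨i, hi, hYi⟩ := hex
    have hoth : ∀ j < n, j ≠ i → Y j ≤ N := by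
      intro j hj hji
      rcases lt_or_gt_of_ne hji with hlt | hgt
      · by_contra hc
        exact h j i hlt hi (by omega) hYi
      · exact not_lt.1 (h i j hgt hj hYi)
    have hsup : (Finset.range n).sup Y = Y i := by
      refine le_antisymm (Finset.sup_le fun j hj => ?_) (Finset.le_sup (Finset.mem_range.2 hi))
      by_cases hji : j = i
      · rw [hji]
      · exact (hoth j (Finset.mem_range.1 hj) hji).trans hYi.le
    have hsum : ∑ j ∈ Finset.range n, Y j =
        (∑ j ∈ Finset.range n, if Y j ≤ N then Y j else 0) + Y i := by
      have h1 : ∑ j ∈ Finset.range n, (if Y j ≤ N then 0 else Y j) = Y i := by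
        rw [Finset.sum_eq_single i, if_neg (by omega)]
        · intro j hj hji
          rw [if_pos (hoth j (Finset.mem_range.1 hj) hji)]
        · intro hni
          exact absurd (Finset.mem_range.2 hi) hni
      rw [← h1, ← Finset.sum_add_distrib]
      refine Finset.sum_congr rfl fun j _ => ?_
      split_ifs <;> simp
    rw [hsup, hsum]
    omega
  -- With no exceedance, truncation changes nothing while trimming still removes a maximum of at
  -- most `N`; this case forces the error `N` in the first bound.
  · push Not at hex
    have hsum : (∑ j ∈ Finset.range n, if Y j ≤ N then Y j else 0) =
        ∑ j ∈ Finset.range n, Y j :=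
      Finset.sum_congr rfl fun j hj => if_pos (hex j (Finset.mem_range.1 hj))
    have hsup : (Finset.range n).sup Y ≤ N :=
      Finset.sup_le fun j hj => hex j (Finset.mem_range.1 hj)
    rw [hsum]
    omega

lemma Icc_one_eq_map (n : ℕ) :
    Finset.Icc 1 n = (Finset.range n).map (addRightEmbedding 1) := by
  ext i
  simp only [Finset.mem_Icc, Finset.mem_map, Finset.mem_range, addRightEmbedding_apply]
  constructor
  · rintro ⟨h1, h2⟩
    exact ⟨i - 1, by omega, by omega⟩
  · rintro ⟨j, h1, rfl⟩
    omega

lemma partialQuotient_mul (i : ℕ) (x : ℝ) :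
    partialQuotient (i + 1) x * partialQuotient (i + 1 + 1) x =
      digit (gaussMap^[i] x) * digit (gaussMap (gaussMap^[i] x)) := by
  unfold partialQuotient digit
  simp only [Nat.add_sub_cancel]
  rw [Function.iterate_succ_apply']

lemma productSum_eq (n : ℕ) (x : ℝ) : productSum n x =
    ∑ i ∈ Finset.range n, digit (gaussMap^[i] x) * digit (gaussMap (gaussMap^[i] x)) := by
  unfold productSum
  rw [Icc_one_eq_map, Finset.sum_map]
  exact Finset.sum_congr rfl fun i _ => partialQuotient_mul i x

lemma productMax_eq (n : ℕ) (x : ℝ) : productMax n x =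
    (Finset.range n).sup fun i =>
      digit (gaussMap^[i] x) * digit (gaussMap (gaussMap^[i] x)) := by
  unfold productMax
  rw [Icc_one_eq_map, Finset.sup_map]
  exact Finset.sup_congr rfl fun i _ => partialQuotient_mul i x

lemma productSum_sub_productMax_bounds {N n : ℕ} {x : ℝ} (hx : x ∉ doubleExceedSet N n) :
    truncSum N n x - N ≤ (productSum n x : ℝ) - productMax n x ∧
      (productSum n x : ℝ) - productMax n x ≤ truncSum N n x := by
  set Y : ℕ → ℕ := fun i => digit (gaussMap^[i] x) * digit (gaussMap (gaussMap^[i] x)) with hY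
  have h := sum_sub_sup_bounds Y N n fun i j hij hj h1 h2 => hx ⟨i, j, hij, hj, h1, h2⟩
  have e : truncSum N n x = ((∑ i ∈ Finset.range n, if Y i ≤ N then Y i else 0 : ℕ) : ℝ) := by
    unfold truncSum truncProd truncPair
    push_cast
    refine Finset.sum_congr rfl fun i _ => ?_
    simp only [hY]
    push_cast
    rfl
  rw [productSum_eq, productMax_eq, e]
  have h1 := (Nat.cast_le (α := ℝ)).2 h.1
  have h2 := (Nat.cast_le (α := ℝ)).2 h.2
  rw [Nat.cast_add, Nat.cast_add] at h1
  rw [Nat.cast_add] at h2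
  constructor <;> linarith

lemma productMax_le_productSum (n : ℕ) (x : ℝ) : productMax n x ≤ productSum n x :=
  Finset.sup_le fun _ hi =>
    Finset.single_le_sum (f := fun i => partialQuotient i x * partialQuotient (i + 1) x)
      (fun _ _ => Nat.zero_le _) hi

lemma truncSum_mono (N : ℕ) (x : ℝ) {m n : ℕ} (h : m ≤ n) : truncSum N m x ≤ truncSum N n x :=
  Finset.sum_le_sum_of_subset_of_nonneg (Finset.range_subset_range.2 h)
    fun _ _ _ => truncProd_nonneg _ _

lemma doubleExceedSet_mono (N : ℕ) {m n : ℕ} (h : m ≤ n) :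
    doubleExceedSet N m ⊆ doubleExceedSet N n := by
  rintro x ⟨i, j, hij, hj, hx⟩
  exact ⟨i, j, hij, hj.trans_le h, hx⟩

/-! ### Asymptotics of the block boundaries, levels and normings. -/

/-- The logarithm of the `m`-th block boundary. -/
def scale (m : ℕ) : ℝ := (m : ℝ) ^ (4 / 5 : ℝ)

/-- The `m`-th block boundary. -/
def radius (m : ℕ) : ℝ := Real.exp (scale m)

/-- The truncation level in the `m`-th block. -/
def level (m : ℕ) : ℕ := ⌈radius m * (m : ℝ) ^ (4 / 3 : ℝ)⌉₊

/-- The normalization `n log² n` at the `m`-th block boundary. -/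
def norming (m : ℕ) : ℝ := radius m * scale m ^ 2

lemma radius_pos (m : ℕ) : 0 < radius m := Real.exp_pos _

lemma tendsto_scale : Tendsto scale atTop atTop :=
  (tendsto_rpow_atTop (by norm_num)).comp tendsto_natCast_atTop_atTop

lemma tendsto_inv_scale : Tendsto (fun m => 1 / scale m) atTop (𝓝 0) :=
  tendsto_const_nhds.div_atTop tendsto_scale

lemma tendsto_inv_radius : Tendsto (fun m => 1 / radius m) atTop (𝓝 0) :=
  tendsto_const_nhds.div_atTop (Real.tendsto_exp_atTop.comp tendsto_scale)

/-- Bernoulli's inequality bounds the increment by `(4/5) m ^ (-1/5)`. The exponent must be below 1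
for this, and it is what makes consecutive boundaries asymptotically equal. -/
lemma tendsto_scale_succ_sub : Tendsto (fun m => scale (m + 1) - scale m) atTop (𝓝 0) := by
  have h1 : Tendsto (fun m : ℕ => 4 / 5 * (m : ℝ) ^ (-(1 / 5 : ℝ))) atTop (𝓝 0) := by
    have := ((tendsto_rpow_neg_atTop (show (0 : ℝ) < 1 / 5 by norm_num)).comp
      tendsto_natCast_atTop_atTop).const_mul (4 / 5 : ℝ)
    simpa using this
  refine tendsto_of_tendsto_of_tendsto_of_le_of_le' tendsto_const_nhds h1 ?_ ?_
  · refine Eventually.of_forall fun m => sub_nonneg.2 ?_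
    exact Real.rpow_le_rpow (by positivity) (by push_cast; linarith) (by norm_num)
  · filter_upwards [eventually_ge_atTop 1] with m hm
    have hm0 : (0 : ℝ) < m := by exact_mod_cast hm
    have h2 := rpow_one_add_le_one_add_mul_self (s := 1 / (m : ℝ)) (p := 4 / 5)
      (by linarith [show 0 < 1 / (m : ℝ) by positivity]) (by norm_num) (by norm_num)
    have h3 : scale (m + 1) = (m : ℝ) ^ (4 / 5 : ℝ) * (1 + 1 / (m : ℝ)) ^ (4 / 5 : ℝ) := by
      unfold scale
      rw [← Real.mul_rpow hm0.le (by positivity)]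
      congr 1
      push_cast
      field_simp
    have h4 : (m : ℝ) ^ (-(1 / 5 : ℝ)) = (m : ℝ) ^ (4 / 5 : ℝ) * (1 / m) := by
      rw [show (-(1 / 5 : ℝ)) = 4 / 5 - 1 by norm_num, Real.rpow_sub_one hm0.ne']
      ring
    rw [h3, h4]
    have := mul_le_mul_of_nonneg_left h2 (show 0 ≤ (m : ℝ) ^ (4 / 5 : ℝ) by positivity)
    unfold scale
    linarith

lemma tendsto_radius_succ_div : Tendsto (fun m => radius (m + 1) / radius m) atTop (𝓝 1) := by
  have := (Real.continuous_exp.tendsto 0).comp tendsto_scale_succ_sub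
  rw [Real.exp_zero] at this
  refine this.congr fun m => ?_
  simp only [Function.comp_apply, radius]
  rw [Real.exp_sub]

lemma tendsto_scale_succ_div : Tendsto (fun m => scale (m + 1) / scale m) atTop (𝓝 1) := by
  have h := (tendsto_scale_succ_sub.mul tendsto_inv_scale).const_add 1
  rw [mul_zero, add_zero] at h
  refine h.congr' ?_
  filter_upwards [tendsto_scale.eventually_gt_atTop 0] with m hm
  field_simp
  ring

lemma tendsto_norming_div_succ : Tendsto (fun m => norming m / norming (m + 1)) atTop (𝓝 1) := by
  have h := (tendsto_radius_succ_div.mul (tendsto_scale_succ_div.pow 2)).inv₀ (by norm_num)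
  simp only [one_pow, mul_one, inv_one] at h
  refine h.congr fun m => ?_
  unfold norming
  rw [div_pow, div_mul_div_comm, inv_div]

lemma tendsto_ceil_radius_div : Tendsto (fun m => (⌈radius m⌉₊ : ℝ) / radius m) atTop (𝓝 1) := by
  have h := tendsto_inv_radius.const_add 1
  rw [add_zero] at h
  refine tendsto_of_tendsto_of_tendsto_of_le_of_le tendsto_const_nhds h (fun m => ?_) fun m => ?_
  · simp only
    rw [le_div_iff₀ (radius_pos m), one_mul]
    exact Nat.le_ceil _
  · simp only
    rw [div_le_iff₀ (radius_pos m), add_mul, one_mul, one_div, inv_mul_cancel₀ (radius_pos m).ne']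
    exact (Nat.ceil_lt_add_one (radius_pos m).le).le

lemma tendsto_ceil_radius_succ_div :
    Tendsto (fun m => (⌈radius (m + 1)⌉₊ : ℝ) / radius m) atTop (𝓝 1) := by
  have h := ((tendsto_add_atTop_iff_nat 1).2 tendsto_ceil_radius_div).mul tendsto_radius_succ_div
  rw [mul_one] at h
  refine h.congr fun m => ?_
  have := radius_pos (m + 1)
  field_simp

lemma level_bounds {m : ℕ} (hm : 1 ≤ m) :
    radius m * (m : ℝ) ^ (4 / 3 : ℝ) ≤ level m ∧
      (level m : ℝ) ≤ 2 * (radius m * (m : ℝ) ^ (4 / 3 : ℝ)) := by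
  refine ⟨Nat.le_ceil _, ?_⟩
  have h1 : (1 : ℝ) ≤ radius m := Real.one_le_exp (by unfold scale; positivity)
  have h2 : (1 : ℝ) ≤ (m : ℝ) ^ (4 / 3 : ℝ) :=
    Real.one_le_rpow (by exact_mod_cast hm) (by norm_num)
  have h3 : 1 ≤ radius m * (m : ℝ) ^ (4 / 3 : ℝ) := one_le_mul_of_one_le_of_one_le h1 h2
  have := (Nat.ceil_lt_add_one (zero_le_one.trans h3)).le
  unfold level
  linarith

lemma one_le_level {m : ℕ} (hm : 1 ≤ m) : 1 ≤ level m := by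
  have : (0 : ℝ) < radius m * (m : ℝ) ^ (4 / 3 : ℝ) :=
    mul_pos (radius_pos m) (Real.rpow_pos_of_pos (by exact_mod_cast hm) _)
  exact Nat.one_le_iff_ne_zero.2 (Nat.ceil_pos.2 this).ne'

lemma tendsto_log_level_div : Tendsto (fun m => Real.log (level m) / scale m) atTop (𝓝 1) := by
  have hlog : Tendsto (fun m : ℕ => Real.log m / scale m) atTop (𝓝 0) :=
    ((isLittleO_log_rpow_atTop (show (0 : ℝ) < 4 / 5 by norm_num)).tendsto_div_nhds_zero).comp
      tendsto_natCast_atTop_atTop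
  have hlo := (hlog.const_mul (4 / 3 : ℝ)).const_add 1
  have hup := hlo.add (tendsto_inv_scale.const_mul (Real.log 2))
  simp only [mul_zero, add_zero] at hlo hup
  refine tendsto_of_tendsto_of_tendsto_of_le_of_le' hlo hup ?_ ?_
  all_goals
    filter_upwards [tendsto_scale.eventually_gt_atTop 0, eventually_ge_atTop 1] with m hs hm
    have hm0 : (0 : ℝ) < m := by exact_mod_cast hm
    have hp : (0 : ℝ) < (m : ℝ) ^ (4 / 3 : ℝ) := by positivity
    have hr := radius_pos m
    obtain ⟨h1, h2⟩ := level_bounds hm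
    have e : Real.log (radius m * (m : ℝ) ^ (4 / 3 : ℝ)) = scale m + 4 / 3 * Real.log m := by
      rw [Real.log_mul hr.ne' hp.ne', Real.log_rpow hm0, radius, Real.log_exp]
  · rw [le_div_iff₀ hs]
    have := Real.log_le_log (by positivity) h1
    rw [e] at this
    refine le_trans (le_of_eq ?_) this
    field_simp
  · rw [div_le_iff₀ hs]
    have := Real.log_le_log (lt_of_lt_of_le (by positivity) h1) h2
    rw [Real.log_mul (by norm_num) (by positivity), e] at this
    refine this.trans (le_of_eq ?_)
    field_simp
    ring

lemma tendsto_level_div_norming : Tendsto (fun m => (level m : ℝ) / norming m) atTop (𝓝 0) := by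
  have h1 : Tendsto (fun m : ℕ => 2 * (m : ℝ) ^ (-(4 / 15 : ℝ))) atTop (𝓝 0) := by
    have := ((tendsto_rpow_neg_atTop (show (0 : ℝ) < 4 / 15 by norm_num)).comp
      tendsto_natCast_atTop_atTop).const_mul (2 : ℝ)
    simpa using this
  refine tendsto_of_tendsto_of_tendsto_of_le_of_le' tendsto_const_nhds h1 ?_ ?_
  · refine Eventually.of_forall fun m => ?_
    have := (radius_pos m).le
    unfold norming
    positivity
  · filter_upwards [eventually_ge_atTop 1] with m hm
    have hm0 : (0 : ℝ) < m := by exact_mod_cast hm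
    have hr := radius_pos m
    have hs : 0 < scale m := Real.rpow_pos_of_pos hm0 _
    unfold norming
    rw [div_le_iff₀ (by positivity)]
    refine (level_bounds hm).2.trans (le_of_eq ?_)
    have : (m : ℝ) ^ (4 / 3 : ℝ) = (m : ℝ) ^ (-(4 / 15 : ℝ)) * scale m ^ 2 := by
      unfold scale
      rw [← Real.rpow_natCast, ← Real.rpow_mul hm0.le, ← Real.rpow_add hm0]
      norm_num
    rw [this]
    ring

lemma eventually_one_add_log_level_le : ∀ᶠ m in atTop, 1 + Real.log (level m) ≤ 3 * scale m := by
  filter_upwards [tendsto_log_level_div.eventually_le_const (show (1 : ℝ) < 2 by norm_num),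
    tendsto_scale.eventually_ge_atTop 1] with m h1 h2
  rw [div_le_iff₀ (by linarith)] at h1
  linarith

lemma tendsto_truncMean_level_div :
    Tendsto (fun m => truncMean (level m) / scale m ^ 2) atTop (𝓝 (1 / (2 * Real.log 2))) := by
  have hl : 0 < Real.log 2 := Real.log_pos (by norm_num)
  have hA := (tendsto_log_level_div.pow 2).const_mul (1 / 2 : ℝ)
  have hB := ((tendsto_inv_scale.mul tendsto_inv_scale).add
    (tendsto_log_level_div.mul tendsto_inv_scale)).const_mul (6 : ℝ)
  have hlo := (hA.sub hB).div_const (Real.log 2)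
  have hup := (hA.add hB).div_const (Real.log 2)
  have e : (1 / 2 : ℝ) / Real.log 2 = 1 / (2 * Real.log 2) := by field_simp
  simp only [one_pow, mul_one, mul_zero, add_zero, sub_zero, e] at hlo hup
  refine tendsto_of_tendsto_of_tendsto_of_le_of_le' hlo hup ?_ ?_
  all_goals
    filter_upwards [tendsto_scale.eventually_gt_atTop 0, eventually_ge_atTop 1] with m hs hm
  · have h := le_truncMean (one_le_level hm)
    rw [div_le_div_iff₀ hl (by positivity), mul_comm (truncMean _)]
    refine le_trans (le_of_eq ?_) h
    field_simp
  · have h := truncMean_le (one_le_level hm)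
    rw [div_le_div_iff₀ (by positivity) hl, mul_comm (truncMean _)]
    refine h.trans (le_of_eq ?_)
    field_simp

lemma summable_rpow_neg : Summable fun m : ℕ => (m : ℝ) ^ (-(16 / 15 : ℝ)) :=
  Real.summable_nat_rpow.2 (by norm_num)

/-! ### Almost sure behaviour along the blocks. -/

/-- The centred sums vanish by summable variances, and the means converge. The length `c` is left
free because the level of block `m` is needed with both the lower and the upper end of the block. -/
lemma ae_tendsto_truncSum_div {c : ℕ → ℕ}
    (hc : Tendsto (fun m => (c m : ℝ) / radius m) atTop (𝓝 1)) :
    ∀ᵐ x ∂gaussMeasure, Tendsto (fun m => truncSum (level m) (c m) x / norming m) atTop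
      (𝓝 (1 / (2 * Real.log 2))) := by
  have hmean : Tendsto (fun m => (c m : ℝ) * truncMean (level m) / norming m) atTop
      (𝓝 (1 / (2 * Real.log 2))) := by
    have := hc.mul tendsto_truncMean_level_div
    rw [one_mul] at this
    refine this.congr fun m => ?_
    unfold norming
    rw [div_mul_div_comm]
  have hvar : ∀ m, ∫ x, ((truncSum (level m) (c m) x - c m * truncMean (level m)) / norming m) ^ 2
      ∂gaussMeasure ≤ c m * (97 * truncSq (level m)) / norming m ^ 2 := by
    intro m
    simp_rw [div_pow]
    rw [integral_div]
    exact div_le_div_of_nonneg_right (variance_truncSum_le _ _) (sq_nonneg _)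
  have hsum : Summable fun m =>
      ∫ x, ((truncSum (level m) (c m) x - c m * truncMean (level m)) / norming m) ^ 2
        ∂gaussMeasure := by
    refine summable_of_isBigO_nat summable_rpow_neg (Asymptotics.IsBigO.of_bound 2328 ?_)
    filter_upwards [hc.eventually_le_const (show (1 : ℝ) < 2 by norm_num),
      eventually_one_add_log_level_le, eventually_ge_atTop 1] with m h1 h2 hm
    have hm0 : (0 : ℝ) < m := by exact_mod_cast hm
    have hr := radius_pos m
    have hs : 0 < scale m := Real.rpow_pos_of_pos hm0 _
    have hp : 0 < (m : ℝ) ^ (4 / 3 : ℝ) := Real.rpow_pos_of_pos hm0 _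
    rw [div_le_iff₀ hr] at h1
    rw [Real.norm_of_nonneg (integral_nonneg fun x => sq_nonneg _),
      Real.norm_of_nonneg (by positivity)]
    refine (hvar m).trans ?_
    unfold norming
    rw [div_le_iff₀ (by positivity)]
    have hL : 0 ≤ 1 + Real.log (level m) :=
      add_nonneg zero_le_one (Real.log_nonneg (by exact_mod_cast one_le_level hm))
    have hQ0 : 0 ≤ truncSq (level m) := (sq_nonneg _).trans (truncMean_sq_le _)
    have hQ : truncSq (level m) ≤ 2 * (2 * (radius m * (m : ℝ) ^ (4 / 3 : ℝ)) * (3 * scale m)) := by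
      refine (truncSq_le _).trans ?_
      have := (level_bounds hm).2
      gcongr
    -- Exponents: `3 * (4/5) - 16/15 = 4/3`.
    have e : (m : ℝ) ^ (-(16 / 15 : ℝ)) * scale m ^ 3 = (m : ℝ) ^ (4 / 3 : ℝ) := by
      unfold scale
      rw [← Real.rpow_natCast, ← Real.rpow_mul hm0.le, ← Real.rpow_add hm0]
      norm_num
    calc (c m : ℝ) * (97 * truncSq (level m))
        ≤ 2 * radius m *
          (97 * (2 * (2 * (radius m * (m : ℝ) ^ (4 / 3 : ℝ)) * (3 * scale m)))) := by gcongr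
      _ = 2328 * radius m ^ 2 * scale m * (m : ℝ) ^ (4 / 3 : ℝ) := by ring
      _ = _ := by rw [← e]; ring
  have hae := ae_tendsto_zero_of_summable_integral_sq
    (Z := fun m x => (truncSum (level m) (c m) x - c m * truncMean (level m)) / norming m)
    (fun m => (measurable_truncSum_sub _ _).div_const _) (fun m => by
      simp_rw [div_pow]
      exact (integrable_truncSum_sub_sq _ _).div_const _) hsum
  filter_upwards [hae] with x hx
  have := hx.add hmean
  rw [zero_add] at this
  refine this.congr fun m => ?_
  rw [← add_div, sub_add_cancel]

lemma ae_eventually_notMem_doubleExceedSet :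
    ∀ᵐ x ∂gaussMeasure, ∀ᶠ m in atTop, x ∉ doubleExceedSet (level m) ⌈radius (m + 1)⌉₊ := by
  set b : ℕ → ℝ := fun m => (⌈radius (m + 1)⌉₊ : ℝ) * (10 / level m) +
    (⌈radius (m + 1)⌉₊ : ℝ) ^ 2 * (8 * (6 * (1 + Real.log (level m)) / level m) ^ 2) with hb
  have hsum : Summable b := by
    refine summable_of_isBigO_nat summable_rpow_neg (Asymptotics.IsBigO.of_bound 10388 ?_)
    filter_upwards [tendsto_ceil_radius_succ_div.eventually_le_const (show (1 : ℝ) < 2 by norm_num),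
      eventually_one_add_log_level_le, eventually_ge_atTop 1] with m h1 h2 hm
    have hm0 : (0 : ℝ) < m := by exact_mod_cast hm
    have hr := radius_pos m
    have hs : 0 < scale m := Real.rpow_pos_of_pos hm0 _
    have hp : 0 < (m : ℝ) ^ (4 / 3 : ℝ) := Real.rpow_pos_of_pos hm0 _
    have hlev := (level_bounds hm).1
    have hlev0 : (0 : ℝ) < level m := by exact_mod_cast one_le_level hm
    rw [div_le_iff₀ hr] at h1
    have hL : 0 ≤ 1 + Real.log (level m) :=
      add_nonneg zero_le_one (Real.log_nonneg (by exact_mod_cast one_le_level hm))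
    rw [Real.norm_of_nonneg (by positivity), Real.norm_of_nonneg (by positivity)]
    have e1 : (m : ℝ) ^ (-(16 / 15 : ℝ)) * ((m : ℝ) ^ (4 / 3 : ℝ)) ^ 2 = scale m ^ 2 := by
      unfold scale
      rw [← Real.rpow_natCast, ← Real.rpow_natCast, ← Real.rpow_mul hm0.le,
        ← Real.rpow_mul hm0.le, ← Real.rpow_add hm0]
      norm_num
    have e2 : 1 / (m : ℝ) ^ (4 / 3 : ℝ) ≤ (m : ℝ) ^ (-(16 / 15 : ℝ)) := by
      rw [one_div, ← Real.rpow_neg hm0.le]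
      exact Real.rpow_le_rpow_of_exponent_le (by exact_mod_cast hm) (by norm_num)
    calc b m ≤ 2 * radius m * (10 / (radius m * (m : ℝ) ^ (4 / 3 : ℝ))) +
          (2 * radius m) ^ 2 *
            (8 * (6 * (3 * scale m) / (radius m * (m : ℝ) ^ (4 / 3 : ℝ))) ^ 2) := by
          simp only [hb]
          gcongr
      _ = 20 * (1 / (m : ℝ) ^ (4 / 3 : ℝ)) + 10368 * (m : ℝ) ^ (-(16 / 15 : ℝ)) := by
          have : (m : ℝ) ^ (-(16 / 15 : ℝ)) = scale m ^ 2 / ((m : ℝ) ^ (4 / 3 : ℝ)) ^ 2 := by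
            rw [eq_div_iff (by positivity), e1]
          rw [this]
          field_simp
          ring
      _ ≤ _ := by linarith
  -- The index is shifted because `level 0 = 0`, while the measure bound needs a level of at least
  -- 1.
  have hne : ∑' m, gaussMeasure (doubleExceedSet (level (m + 1)) ⌈radius (m + 1 + 1)⌉₊) ≠ ⊤ := by
    refine ne_top_of_le_ne_top ((summable_nat_add_iff 1).2 hsum).tsum_ofReal_ne_top
      (ENNReal.tsum_le_tsum fun m => ?_)
    exact measure_doubleExceedSet_le (one_le_level (by omega)) _
  filter_upwards [ae_eventually_notMem hne] with x hx
  rw [← map_add_atTop_eq_nat 1]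
  exact hx

/-! ### Interpolation inside the blocks. -/

/-- The index of the block that contains `n`. -/
def blockIndex (n : ℕ) : ℕ := ⌊Real.log n ^ (5 / 4 : ℝ)⌋₊

lemma tendsto_blockIndex : Tendsto blockIndex atTop atTop :=
  tendsto_nat_floor_atTop.comp ((tendsto_rpow_atTop (by norm_num)).comp
    (Real.tendsto_log_atTop.comp tendsto_natCast_atTop_atTop))

lemma scale_blockIndex_le {n : ℕ} (hn : 1 ≤ n) : scale (blockIndex n) ≤ Real.log n := by
  have hL : 0 ≤ Real.log n := Real.log_nonneg (by exact_mod_cast hn)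
  have h := Real.rpow_le_rpow (by positivity) (Nat.floor_le (Real.rpow_nonneg hL (5 / 4)))
    (show (0 : ℝ) ≤ 4 / 5 by norm_num)
  rw [← Real.rpow_mul hL] at h
  norm_num at h
  simpa [scale, blockIndex] using h

lemma le_scale_blockIndex_succ {n : ℕ} (hn : 1 ≤ n) : Real.log n ≤ scale (blockIndex n + 1) := by
  have hL : 0 ≤ Real.log n := Real.log_nonneg (by exact_mod_cast hn)
  have h := Real.rpow_le_rpow (Real.rpow_nonneg hL (5 / 4))
    (Nat.lt_floor_add_one (Real.log n ^ (5 / 4 : ℝ))).le (show (0 : ℝ) ≤ 4 / 5 by norm_num)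
  rw [← Real.rpow_mul hL] at h
  norm_num at h
  simpa [scale, blockIndex] using h

lemma scale_nonneg (m : ℕ) : 0 ≤ scale m := Real.rpow_nonneg (by positivity) _

lemma radius_blockIndex_le {n : ℕ} (hn : 1 ≤ n) : radius (blockIndex n) ≤ n := by
  unfold radius
  rw [← Real.le_log_iff_exp_le (by exact_mod_cast hn)]
  exact scale_blockIndex_le hn

lemma le_radius_blockIndex_succ {n : ℕ} (hn : 1 ≤ n) : n ≤ radius (blockIndex n + 1) := by
  unfold radius
  rw [← Real.log_le_iff_le_exp (by exact_mod_cast hn)]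
  exact le_scale_blockIndex_succ hn

lemma norming_blockIndex_le {n : ℕ} (hn : 1 ≤ n) :
    norming (blockIndex n) ≤ n * Real.log n ^ 2 := by
  have h0 := scale_nonneg (blockIndex n)
  unfold norming
  exact mul_le_mul (radius_blockIndex_le hn) (pow_le_pow_left₀ h0 (scale_blockIndex_le hn) 2)
    (sq_nonneg _) (by positivity)

lemma le_norming_blockIndex_succ {n : ℕ} (hn : 1 ≤ n) :
    n * Real.log n ^ 2 ≤ norming (blockIndex n + 1) := by
  unfold norming
  exact mul_le_mul (le_radius_blockIndex_succ hn)
    (pow_le_pow_left₀ (Real.log_nonneg (by exact_mod_cast hn)) (le_scale_blockIndex_succ hn) 2)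
    (sq_nonneg _) (radius_pos _).le

/-- Absence of double exceedances up to the upper end of the block covers every `n` inside it, with
one common level. Since truncated sums grow with `n`, the quotient lies between the two end values
divided by the opposite normings, apart from the negligible level. -/
lemma tendsto_of_block_limits {x c : ℝ}
    (hx : ∀ᶠ m in atTop, x ∉ doubleExceedSet (level m) ⌈radius (m + 1)⌉₊)
    (hlo : Tendsto (fun m => truncSum (level m) ⌈radius m⌉₊ x / norming m) atTop (𝓝 c))
    (hup : Tendsto (fun m => truncSum (level m) ⌈radius (m + 1)⌉₊ x / norming m) atTop (𝓝 c)) :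
    Tendsto (fun n : ℕ => ((productSum n x : ℝ) - (productMax n x : ℝ)) /
      ((n : ℝ) * Real.log (n : ℝ) ^ 2)) atTop (𝓝 c) := by
  have hlo' := (hlo.sub tendsto_level_div_norming).mul tendsto_norming_div_succ
  rw [sub_zero, mul_one] at hlo'
  refine tendsto_of_tendsto_of_tendsto_of_le_of_le' (hlo'.comp tendsto_blockIndex)
    (hup.comp tendsto_blockIndex) ?_ ?_
  all_goals
    filter_upwards [tendsto_blockIndex.eventually hx, eventually_ge_atTop 1,
      tendsto_blockIndex.eventually (eventually_ge_atTop 1)] with n hxn hn hm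
    simp only [Function.comp_apply]
    set m := blockIndex n with hmdef
    have hm0 : (0 : ℝ) < m := by exact_mod_cast hm
    have hs : 0 < scale m := Real.rpow_pos_of_pos hm0 _
    have hD : 0 < norming m := mul_pos (radius_pos m) (pow_pos hs 2)
    have hD1 := norming_blockIndex_le hn
    have hD2 := le_norming_blockIndex_succ hn
    rw [← hmdef] at hD1 hD2
    have hn1 : ⌈radius m⌉₊ ≤ n := Nat.ceil_le.2 (radius_blockIndex_le hn)
    have hn2 : n ≤ ⌈radius (m + 1)⌉₊ := by
      exact_mod_cast (le_radius_blockIndex_succ hn).trans (Nat.le_ceil _)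
    obtain ⟨h1, h2⟩ := productSum_sub_productMax_bounds
      (fun h => hxn (doubleExceedSet_mono (level m) hn2 h))
    -- Nonnegativity is needed to enlarge the denominator in the lower bound, where the truncated
    -- sum minus the level could be negative.
    have h3 : (0 : ℝ) ≤ (productSum n x : ℝ) - productMax n x :=
      sub_nonneg.2 (by exact_mod_cast productMax_le_productSum n x)
  · have hD' : 0 < norming (m + 1) := hD.trans_le (hD1.trans hD2)
    have h4 := truncSum_mono (level m) x hn1
    calc _ = (truncSum (level m) ⌈radius m⌉₊ x - level m) / norming (m + 1) := by
          rw [← sub_div, div_mul_div_cancel₀ hD.ne']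
      _ ≤ ((productSum n x : ℝ) - productMax n x) / norming (m + 1) :=
          div_le_div_of_nonneg_right (by linarith) hD'.le
      _ ≤ _ := div_le_div_of_nonneg_left h3 (hD.trans_le hD1) hD2
  · exact div_le_div₀ (truncSum_nonneg _ _ _) (h2.trans (truncSum_mono _ x hn2)) hD hD1

end

end ContFracSums

theorem theorem1p5 :
    ∀ᵐ x ∂(volume.restrict (Set.Ioo (0 : ℝ) 1)),
      Tendsto
        (fun n : ℕ =>
          ((ContFracSums.productSum n x : ℝ) - (ContFracSums.productMax n x : ℝ)) /
            ((n : ℝ) * Real.log (n : ℝ) ^ 2))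
        atTop (𝓝 (1 / (2 * Real.log 2))) := by
  refine ContFracSums.restrict_absolutelyContinuous_gaussMeasure.ae_le ?_
  filter_upwards [ContFracSums.ae_eventually_notMem_doubleExceedSet,
    ContFracSums.ae_tendsto_truncSum_div ContFracSums.tendsto_ceil_radius_div,
    ContFracSums.ae_tendsto_truncSum_div ContFracSums.tendsto_ceil_radius_succ_div]
    with x h1 h2 h3
  exact ContFracSums.tendsto_of_block_limits h1 h2 h3
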